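/- **Theorem 2 (Optimal one-sided approximations).** Let $\lambda>0$, let $G_\lambda(z)=e^{-\pi\lambda z^2}$ for $z\in\mathbb{C}$, and let $G^+_\lambda:\mathbb{R}\to\mathbb{R}$ be the truncated Gaussian, $G^+_\lambda(x)=G_\lambda(x)$ for $x>0$, $G^+_\lambda(0)=\tfrac12$, $G^+_\lambda(x)=0$ for $x<0$. Write $\theta_3(0,i\lambda)=\sum_{n\in\mathbb{Z}}e^{-\pi\lambda n^2}$. An entire function $F$ is said to be of exponential type at most $2\pi$ if for every $\varepsilon>0$ there is $C_\varepsilon>0$ with $|F(z)|\le C_\varepsilon e^{(2\pi+\varepsilon)|z|}$ for all $z\in\mathbb{C}$. The functions $$L^+_\lambda(z)=\frac{\sin^2\pi z}{\pi^2}\sum_{n=1}^\infty\left\{\frac{G_\lambda(n)}{(z-n)^2}+\frac{G_\lambda'(n)}{z-n}-\frac{G_\lambda'(n)}{z}\right\},\qquad M^+_\lambda(z)=L^+_\lambda(z)+\frac{\sin^2\pi z}{\pi^2z^2},$$ initially defined for $z\in\mathbb{C}\setminus\{0,1,2,\dots\}$, extend by continuity to entire functions of exponential type at most $2\pi$, again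 denoted $L^+_\lambda$ and $M^+_\lambda$. They are real-valued on $\mathbb{R}$, and $$L^+_\lambda(x)\le G^+_\lambda(x)\le M^+_\lambda(x)\qquad\text{for all }x\in\mathbb{R}.$$ (i) Let $L$ be an entire function of exponential type at most $2\pi$ which is real-valued on $\mathbb{R}$ and satisfies $L(x)\le G^+_\lambda(x)$ for all real $x$. Then $$\int_{-\infty}^\infty\{G^+_\lambda(x)-L(x)\}\,dx\ \ge\ -\frac{\theta_3(0,i\lambda)}{2}+\frac12+\frac1{2\sqrt\lambda},$$ with equality if and only if $L=L^+_\lambda$. (ii) Let $M$ be an entire function of exponential type at most $2\pi$ which is real-valued on $\mathbb{R}$ and satisfies $M(x)\ge G^+_\lambda(x)$ for all real $x$. Then $$\int_{-\infty}^\infty\{M(x)-G^+_\lambda(x)\}\,dx\ \ge\ \frac{\theta_3(0,i\lambda)}{2}+\frac12-\frac1{2\sqrt\lambda},$$ with equality if and only if $M=M^+_\lambda$. The integrands are nonnegative; the integrals are taken in $[0,\infty]$. -/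

import Mathlib

open Filter
open scoped Topology ENNReal
open MeasureTheory Filter

namespace TruncatedGaussian

/-- The Gaussian `G_λ(z) = exp (-π λ z²)` as an entire function. -/
noncomputable def gaussian (lam : ℝ) (z : ℂ) : ℂ :=
  Complex.exp (-(Real.pi : ℂ) * (lam : ℂ) * z ^ 2)

/-- The truncated Gaussian `G⁺_λ` on the real line, with value `1/2` at the origin. -/
noncomputable def gaussianPlus (lam x : ℝ) : ℝ :=
  if 0 < x then Real.exp (-Real.pi * lam * x ^ 2) else if x = 0 then 1 / 2 else 0

/-- `F` is an entire function of exponential type at most `σ`. -/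
def IsEntireOfExpType (σ : ℝ) (F : ℂ → ℂ) : Prop :=
  Differentiable ℂ F ∧
    ∀ ε : ℝ, 0 < ε → ∃ C : ℝ, 0 < C ∧ ∀ z : ℂ, ‖F z‖ ≤ C * Real.exp ((σ + ε) * ‖z‖)

/-- The interpolation series defining `L⁺_λ` away from the nonnegative integers. The index `n`
stands for the interpolation point `n + 1`. -/
noncomputable def minorantSeries (lam : ℝ) (z : ℂ) : ℂ :=
  Complex.sin (Real.pi * z) ^ 2 / (Real.pi : ℂ) ^ 2 *
    ∑' n : ℕ, (gaussian lam ((n : ℂ) + 1) / (z - ((n : ℂ) + 1)) ^ 2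
      + deriv (gaussian lam) ((n : ℂ) + 1) / (z - ((n : ℂ) + 1))
      - deriv (gaussian lam) ((n : ℂ) + 1) / z)

/-- The series defining `M⁺_λ` away from the nonnegative integers. -/
noncomputable def majorantSeries (lam : ℝ) (z : ℂ) : ℂ :=
  minorantSeries lam z + Complex.sin (Real.pi * z) ^ 2 / ((Real.pi : ℂ) ^ 2 * z ^ 2)

/-- `L⁺_λ`: the extension by continuity of its series to all of `ℂ`. -/
noncomputable def Lplus (lam : ℝ) (z : ℂ) : ℂ :=
  limUnder (𝓝[≠] z) (minorantSeries lam)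

/-- `M⁺_λ`: the extension by continuity of its series to all of `ℂ`. -/
noncomputable def Mplus (lam : ℝ) (z : ℂ) : ℂ :=
  limUnder (𝓝[≠] z) (majorantSeries lam)

/-- The real number `θ₃(0, iλ) = ∑_{n ∈ ℤ} exp (-π λ n²)`. -/
noncomputable def thetaValue (lam : ℝ) : ℝ :=
  (jacobiTheta₂ 0 (Complex.I * (lam : ℂ))).re

end TruncatedGaussian

/-! ### Exponential type: Phragmén–Lindelöf and `L¹` bounds on horizontal lines -/

namespace TruncatedGaussian

section ExponentialType

variable {σ : ℝ} {F G : ℂ → ℂ}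

/-! Optimality comes from Poisson summation. If `F` is entire of type `2π` and integrable on `ℝ`,
its Fourier transform vanishes for `|ξ| ≥ 1` (`fourier_eq_zero_of_one_le_abs`), so `∫ F = ∑ F(n)`
(`tsum_add_int`). A minorant `L` with finite integral defect is integrable. It satisfies `L(n) ≤
G⁺(n)` for `n ≠ 0`, and the left limit at the jump forces `L(0) ≤ 0`; hence `∫ L ≤ ∑_{m ≥ 1} exp (-π
λ m²) = (θ₃ - 1) / 2`, while `∫ G⁺ = 1 / (2 √λ)`. For majorants the right limit forces `M(0) ≥ 1`.
In the case of equality all values at the integers are prescribed, and so are the derivatives at the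
nonzero integers, since a one-sided approximant is tangent to `G⁺` where it touches it. These data
determine the function (`eq_zero_of_double_zeros`): Poisson summation for `F` and for `F'` gives two
linear equations for the Fourier transform on `(0, 1)` and `(-1, 0)`.

It remains to show that the interpolating functions are themselves a minorant and a majorant. Put `a
= π λ` and write `L⁺(x) = sin² (π x) / π² · C(x, a)`, with `C` the function `cSum`. The key identity
(`hasDerivAt_exp_mul_cSum`) is `∂ₐ [exp (a x²) C(x, a)] = -exp (a x²) (p(a) + 2 r(a) / x)`, where
`p`, `r` are the Gaussian sums `pSum`, `rSum`, independent of `x`. Since `0 ≤ p ≤ 1/2` and `r ≥ 0`,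
suitable combinations are monotone in `a`, and letting `a → 0⁺` compares them with the partial
fractions of `π² / sin² (π x)`. This yields `exp_mul_cSum_le` and `pi_sq_div_sin_sq_le`. For `x < 0`
the sign `C ≤ 0` is obtained separately by a telescoping estimate (`gsum_left_nonneg`).

The signs of the Gaussian sums come from the theta functional equation. Differentiated once, it
gives `p ≤ 1/2`. Differentiated twice, it gives a self-duality of `v = -p'/2` under `a ↦ π² / a`,
whence `v ≥ 0` and then `p ≥ 0`. Finally `r` is, up to a constant, a half-order integral of `v`. -/

lemma IsEntireOfExpType.sub (hF : IsEntireOfExpType σ F) (hG : IsEntireOfExpType σ G) :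
    IsEntireOfExpType σ (fun z => F z - G z) := by
  refine ⟨hF.1.sub hG.1, fun ε hε => ?_⟩
  obtain ⟨C, hC, h⟩ := hF.2 ε hε
  obtain ⟨D, hD, k⟩ := hG.2 ε hε
  refine ⟨C + D, by positivity, fun z => (norm_sub_le _ _).trans ?_⟩
  rw [add_mul]
  exact add_le_add (h z) (k z)

lemma IsEntireOfExpType.comp_add (hσ : 0 ≤ σ) (hF : IsEntireOfExpType σ F) (c : ℂ) :
    IsEntireOfExpType σ (fun z => F (z + c)) := by
  refine ⟨hF.1.comp (differentiable_id.add_const c), fun ε hε => ?_⟩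
  obtain ⟨C, hC, h⟩ := hF.2 ε hε
  refine ⟨C * Real.exp ((σ + ε) * ‖c‖), by positivity, fun z => (h _).trans ?_⟩
  rw [mul_assoc, ← Real.exp_add, ← mul_add]
  gcongr
  rw [add_comm ‖c‖]
  exact norm_add_le z c

lemma IsEntireOfExpType.comp_neg (hF : IsEntireOfExpType σ F) :
    IsEntireOfExpType σ (fun z => F (-z)) := by
  refine ⟨hF.1.comp differentiable_id.neg, fun ε hε => ?_⟩
  obtain ⟨C, hC, h⟩ := hF.2 ε hε
  exact ⟨C, hC, fun z => by simpa using h (-z)⟩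

lemma IsEntireOfExpType.deriv (hσ : 0 ≤ σ) (hF : IsEntireOfExpType σ F) :
    IsEntireOfExpType σ (deriv F) := by
  refine ⟨hF.1.deriv, fun ε hε => ?_⟩
  obtain ⟨C, hC, h⟩ := hF.2 ε hε
  refine ⟨C * Real.exp ((σ + ε) * 1), by positivity, fun z => ?_⟩
  have := Complex.norm_deriv_le_of_forall_mem_sphere_norm_le (F := ℂ) (c := z) (R := 1)
    (C := C * Real.exp ((σ + ε) * 1) * Real.exp ((σ + ε) * ‖z‖)) (f := F) one_pos
    hF.1.diffContOnCl (fun w hw => (h w).trans ?_)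
  · simpa using this
  · rw [mul_assoc, ← Real.exp_add, ← mul_add]
    gcongr
    have : ‖w - z‖ = 1 := by simpa [dist_eq_norm] using hw
    calc ‖w‖ = ‖(w - z) + z‖ := by simp
      _ ≤ _ := norm_add_le _ _
      _ = _ := by rw [this]

/-- Phragmén–Lindelöf in the upper half plane, rotated to the right half plane. The exponential
factor makes the function bounded on the positive axis and has modulus one on the boundary; the loss
`ε` is removed at the end. -/
lemma IsEntireOfExpType.norm_le_of_im_nonneg (hσ : 0 ≤ σ) (hF : IsEntireOfExpType σ F) {B : ℝ}
    (hB : ∀ x : ℝ, ‖F x‖ ≤ B) {z : ℂ} (hz : 0 ≤ z.im) : ‖F z‖ ≤ B * Real.exp (σ * z.im) := by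
  have key : ∀ ε : ℝ, 0 < ε → ‖F z‖ ≤ B * Real.exp ((σ + ε) * z.im) := by
    intro ε hε
    obtain ⟨C, hC, h⟩ := hF.2 ε hε
    set f : ℂ → ℂ := fun w => F (Complex.I * w) * Complex.exp (-((σ + ε : ℝ) : ℂ) * w) with hf
    have hfn : ∀ w, ‖f w‖ = ‖F (Complex.I * w)‖ * Real.exp (-(σ + ε) * w.re) := by
      intro w
      rw [hf]
      simp only [norm_mul, Complex.norm_exp]
      congr 2
      simp
    have hd : Differentiable ℂ f := by
      have := hF.1
      rw [hf]; fun_prop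
    have := PhragmenLindelof.right_half_plane_of_bounded_on_real (C := B) (f := f)
      (z := -Complex.I * z) hd.diffContOnCl
      ⟨1, by norm_num, 2 * (σ + ε), ?_⟩ ?_ ?_ (by simpa using hz)
    · rw [hfn] at this
      have e1 : Complex.I * (-Complex.I * z) = z := by
        rw [← mul_assoc]; simp
      have e2 : (-Complex.I * z).re = z.im := by simp
      rw [e1, e2, neg_mul, Real.exp_neg, ← div_eq_mul_inv, div_le_iff₀ (Real.exp_pos _)] at this
      exact this
    · refine Asymptotics.IsBigO.of_bound C (Eventually.of_forall fun w => ?_)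
      rw [hfn, Real.norm_of_nonneg (Real.exp_pos _).le]
      have h1 := h (Complex.I * w)
      rw [norm_mul, Complex.norm_I, one_mul] at h1
      calc _ ≤ C * Real.exp ((σ + ε) * ‖w‖) * Real.exp ((σ + ε) * ‖w‖) := by
            have h0 := Complex.abs_re_le_norm w
            have h2 := neg_abs_le w.re
            have h3 : -w.re ≤ ‖w‖ := by linarith
            rw [neg_mul_comm]
            gcongr
        _ = _ := by
            rw [mul_assoc, ← Real.exp_add, Real.rpow_one]
            ring_nf
    · refine Filter.isBoundedUnder_of_eventually_le (a := C) ?_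
      filter_upwards [eventually_ge_atTop 0] with x hx
      rw [hfn]
      have h1 := h (Complex.I * x)
      rw [norm_mul, Complex.norm_I, one_mul, Complex.norm_real, Real.norm_of_nonneg hx] at h1
      calc _ ≤ C * Real.exp ((σ + ε) * x) * Real.exp (-(σ + ε) * x) := by
            rw [Complex.ofReal_re]
            gcongr
        _ = C := by rw [mul_assoc, ← Real.exp_add, ← add_mul]; simp
    · intro x
      rw [hfn]
      have : Complex.I * (x * Complex.I) = ((-x : ℝ) : ℂ) := by
        rw [mul_comm, mul_assoc, Complex.I_mul_I]; simp
      rw [this]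
      simpa using hB (-x)
  have hlim : Tendsto (fun ε : ℝ => B * Real.exp ((σ + ε) * z.im)) (𝓝[>] 0)
      (𝓝 (B * Real.exp ((σ + 0) * z.im))) := by
    refine (Continuous.tendsto ?_ 0).mono_left nhdsWithin_le_nhds
    fun_prop
  rw [add_zero] at hlim
  exact ge_of_tendsto hlim (eventually_nhdsWithin_of_forall fun ε hε => key ε hε)

lemma IsEntireOfExpType.norm_le_of_bounded_on_real (hσ : 0 ≤ σ) (hF : IsEntireOfExpType σ F)
    {B : ℝ} (hB : ∀ x : ℝ, ‖F x‖ ≤ B) (z : ℂ) : ‖F z‖ ≤ B * Real.exp (σ * |z.im|) := by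
  rcases le_total 0 z.im with h | h
  · rw [abs_of_nonneg h]
    exact hF.norm_le_of_im_nonneg hσ hB h
  · rw [abs_of_nonpos h]
    have := hF.comp_neg.norm_le_of_im_nonneg hσ (B := B) (z := -z)
      (fun x => by simpa using hB (-x)) (by simpa using h)
    simpa using this

/-- Averages of translates of `F` against a bounded weight. -/
noncomputable def weightedAverage (F : ℂ → ℂ) (s : ℝ → ℂ) (N : ℝ) (z : ℂ) : ℂ :=
  ∫ t in Set.Icc (-N) N, F (z + t) * s t

variable {s : ℝ → ℂ}

lemma hasDerivAt_weightedAverage (hF : Differentiable ℂ F) (hs : Measurable s)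
    (hs1 : ∀ t, ‖s t‖ ≤ 1) (N : ℝ) (z : ℂ) :
    HasDerivAt (weightedAverage F s N) (weightedAverage (deriv F) s N z) z := by
  have hF' : Continuous (deriv F) := hF.deriv.continuous
  obtain ⟨K, hK⟩ := (isCompact_closedBall (0 : ℂ) (‖z‖ + 1 + |N|)).exists_bound_of_continuousOn
    hF'.continuousOn
  have hmeas : ∀ {H : ℂ → ℂ}, Continuous H → ∀ w : ℂ, Measurable (fun t : ℝ => H (w + t) * s t) :=
    fun hH w => (hH.comp (by fun_prop)).measurable.mul hs
  refine (hasDerivAt_integral_of_dominated_loc_of_deriv_le (bound := fun _ => K)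
    (μ := volume.restrict (Set.Icc (-N) N)) (F := fun w (t : ℝ) => F (w + t) * s t)
    (F' := fun w (t : ℝ) => deriv F (w + t) * s t) (Metric.ball_mem_nhds z one_pos)
    (Eventually.of_forall fun w => (hmeas hF.continuous w).aestronglyMeasurable) ?_
    (hmeas hF' z).aestronglyMeasurable ?_ (integrable_const K) ?_).2
  · have h1 : IntegrableOn (fun t : ℝ => F (z + t)) (Set.Icc (-N) N) :=
      (hF.continuous.comp (by fun_prop)).continuousOn.integrableOn_compact isCompact_Icc
    exact h1.mul_bdd (c := 1) hs.aestronglyMeasurable (Eventually.of_forall hs1)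
  · refine (ae_restrict_iff' measurableSet_Icc).2 (Eventually.of_forall fun t ht w hw => ?_)
    rw [norm_mul]
    have h1 : ‖deriv F (w + t)‖ ≤ K := by
      apply hK
      rw [mem_closedBall_zero_iff]
      have h2 : ‖w - z‖ < 1 := by simpa [dist_eq_norm] using hw
      have h3 : ‖(t : ℂ)‖ ≤ |N| := by
        rw [Complex.norm_real, Real.norm_eq_abs]
        exact (abs_le.2 ht).trans (le_abs_self N)
      calc ‖w + t‖ = ‖z + (w - z) + t‖ := by ring_nf
        _ ≤ ‖z‖ + ‖w - z‖ + ‖(t : ℂ)‖ := norm_add₃_le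
        _ ≤ _ := by linarith
    calc _ ≤ K * 1 := mul_le_mul h1 (hs1 t) (norm_nonneg _) ((norm_nonneg _).trans h1)
      _ = K := mul_one K
  · refine Eventually.of_forall fun t w _ => ?_
    have := (hF (w + t)).hasDerivAt.comp_add_const w (t : ℂ)
    exact this.mul_const (s t)

lemma isEntireOfExpType_weightedAverage (hσ : 0 ≤ σ) (hF : IsEntireOfExpType σ F)
    (hs : Measurable s) (hs1 : ∀ t, ‖s t‖ ≤ 1) (N : ℝ) :
    IsEntireOfExpType σ (weightedAverage F s N) := by
  refine ⟨fun z => (hasDerivAt_weightedAverage hF.1 hs hs1 N z).differentiableAt, fun ε hε => ?_⟩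
  obtain ⟨C, hC, h⟩ := hF.2 ε hε
  refine ⟨C * Real.exp ((σ + ε) * |N|) * (volume.real (Set.Icc (-N) N) + 1), by positivity,
    fun z => ?_⟩
  have : ‖weightedAverage F s N z‖ ≤
      C * Real.exp ((σ + ε) * |N|) * Real.exp ((σ + ε) * ‖z‖) * volume.real (Set.Icc (-N) N) := by
    refine norm_setIntegral_le_of_norm_le_const (by simp [Real.volume_Icc]) fun t ht => ?_
    have h3 : ‖(t : ℂ)‖ ≤ |N| := by
      rw [Complex.norm_real, Real.norm_eq_abs]
      exact (abs_le.2 ht).trans (le_abs_self N)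
    have h1 : ‖F (z + t)‖ ≤ C * Real.exp ((σ + ε) * |N|) * Real.exp ((σ + ε) * ‖z‖) := by
      refine (h _).trans ?_
      rw [mul_assoc, ← Real.exp_add, ← mul_add]
      gcongr
      rw [add_comm |N|]
      exact (norm_add_le _ _).trans (by gcongr)
    rw [norm_mul]
    calc _ ≤ _ * 1 := mul_le_mul h1 (hs1 t) (norm_nonneg _) (by positivity)
      _ = _ := mul_one _
  refine this.trans ?_
  calc _ ≤ C * Real.exp ((σ + ε) * |N|) * Real.exp ((σ + ε) * ‖z‖) *
      (volume.real (Set.Icc (-N) N) + 1) := by gcongr; simp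
    _ = _ := by ring

/-- On the real line the average is at most the `L¹` norm of `F`, uniformly in `N` and `s`, so
Phragmén–Lindelöf carries the bound into the plane. Choosing `s` by duality then turns this
pointwise bound into `L¹` bounds. -/
lemma norm_weightedAverage_le (hσ : 0 ≤ σ) (hF : IsEntireOfExpType σ F)
    (hint : Integrable (fun x : ℝ => F x)) (hs : Measurable s) (hs1 : ∀ t, ‖s t‖ ≤ 1) (N : ℝ)
    (z : ℂ) : ‖weightedAverage F s N z‖ ≤ (∫ x : ℝ, ‖F x‖) * Real.exp (σ * |z.im|) := by
  refine (isEntireOfExpType_weightedAverage hσ hF hs hs1 N).norm_le_of_bounded_on_real hσ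
    (fun x => ?_) z
  have hx : Integrable (fun t : ℝ => ‖F ((x + t : ℝ) : ℂ)‖) :=
    (hint.comp_add_left x).norm
  calc ‖weightedAverage F s N x‖ ≤ ∫ t in Set.Icc (-N) N, ‖F ((x + t : ℝ) : ℂ)‖ := by
        refine norm_integral_le_of_norm_le hx.integrableOn (Eventually.of_forall fun t => ?_)
        rw [norm_mul]
        push_cast
        exact mul_le_of_le_one_right (norm_nonneg _) (hs1 t)
    _ ≤ ∫ t : ℝ, ‖F ((x + t : ℝ) : ℂ)‖ :=
        setIntegral_le_integral hx (Eventually.of_forall fun t => norm_nonneg _)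
    _ = _ := integral_add_left_eq_self (fun t : ℝ => ‖F (t : ℂ)‖) x

/-- The unimodular factor turning `f` into `‖f‖`. -/
noncomputable def phaseInv (w : ℂ) : ℂ := (starRingEnd ℂ w) / ‖w‖

lemma norm_phaseInv_le (w : ℂ) : ‖phaseInv w‖ ≤ 1 := by
  rw [phaseInv, norm_div, RCLike.norm_conj, Complex.norm_real, norm_norm]
  exact div_self_le_one _

lemma mul_phaseInv (w : ℂ) : w * phaseInv w = ‖w‖ := by
  rcases eq_or_ne w 0 with rfl | h
  · simp
  · have : (‖w‖ : ℂ) ≠ 0 := by simpa using h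
    rw [phaseInv, mul_div_assoc', Complex.mul_conj', div_eq_iff this, sq]

lemma measurable_phaseInv : Measurable phaseInv := by
  unfold phaseInv
  fun_prop

lemma integrable_of_bound_on_Icc {f : ℝ → ℂ} (hf : Continuous f) {B : ℝ}
    (h : ∀ N : ℕ, ∫ t in Set.Icc (-(N : ℝ)) N, ‖f t‖ ≤ B) : Integrable f := by
  refine integrable_of_intervalIntegral_norm_bounded (l := atTop) (a := fun N : ℕ => -(N : ℝ))
    (b := fun N : ℕ => (N : ℝ)) B ?_ ?_ tendsto_natCast_atTop_atTop ?_
  · exact fun N => (hf.continuousOn.integrableOn_compact isCompact_Icc).mono_set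
      Set.Ioc_subset_Icc_self
  · exact tendsto_neg_atTop_atBot.comp tendsto_natCast_atTop_atTop
  · refine Eventually.of_forall fun N => ?_
    have : -(N : ℝ) ≤ N := by
      have : (0 : ℝ) ≤ N := N.cast_nonneg
      linarith
    rw [intervalIntegral.integral_of_le this, ← integral_Icc_eq_integral_Ioc]
    exact h N

lemma integral_le_of_bound_on_Icc {f : ℝ → ℂ} (hf : Continuous f) {B : ℝ}
    (h : ∀ N : ℕ, ∫ t in Set.Icc (-(N : ℝ)) N, ‖f t‖ ≤ B) : ∫ t : ℝ, ‖f t‖ ≤ B := by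
  have hi := integrable_of_bound_on_Icc hf h
  have := intervalIntegral_tendsto_integral (a := fun N : ℕ => -(N : ℝ))
    (b := fun N : ℕ => (N : ℝ)) (l := atTop) hi.norm
    (tendsto_neg_atTop_atBot.comp tendsto_natCast_atTop_atTop) tendsto_natCast_atTop_atTop
  refine le_of_tendsto this (Eventually.of_forall fun N => ?_)
  have h0 : -(N : ℝ) ≤ N := by
    have : (0 : ℝ) ≤ N := N.cast_nonneg
    linarith
  rw [intervalIntegral.integral_of_le h0, ← integral_Icc_eq_integral_Ioc]
  exact h N

/-- Plancherel–Pólya by duality: with `s` the conjugate phase of `F (z + t)`, the average at `z`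
itself is the integral of the norm. -/
lemma setIntegral_norm_horizontal_le (hσ : 0 ≤ σ) (hF : IsEntireOfExpType σ F)
    (hint : Integrable (fun x : ℝ => F x)) (z : ℂ) (N : ℝ) :
    ∫ t in Set.Icc (-N) N, ‖F (z + t)‖ ≤ (∫ x : ℝ, ‖F x‖) * Real.exp (σ * |z.im|) := by
  have hc : Continuous fun t : ℝ => F (z + t) := hF.1.continuous.comp (by fun_prop)
  have := norm_weightedAverage_le hσ hF hint (s := fun t => phaseInv (F (z + t)))
    (measurable_phaseInv.comp hc.measurable) (fun t => norm_phaseInv_le _) N z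
  rw [weightedAverage] at this
  simp only [mul_phaseInv] at this
  rw [integral_complex_ofReal, Complex.norm_real] at this
  exact (le_abs_self _).trans this

lemma IsEntireOfExpType.integrable_horizontal (hσ : 0 ≤ σ) (hF : IsEntireOfExpType σ F)
    (hint : Integrable (fun x : ℝ => F x)) (z : ℂ) : Integrable (fun t : ℝ => F (z + t)) :=
  integrable_of_bound_on_Icc (hF.1.continuous.comp (by fun_prop))
    fun N => setIntegral_norm_horizontal_le hσ hF hint z N

lemma IsEntireOfExpType.integral_norm_horizontal_le (hσ : 0 ≤ σ) (hF : IsEntireOfExpType σ F)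
    (hint : Integrable (fun x : ℝ => F x)) (z : ℂ) :
    ∫ t : ℝ, ‖F (z + t)‖ ≤ (∫ x : ℝ, ‖F x‖) * Real.exp (σ * |z.im|) :=
  integral_le_of_bound_on_Icc (hF.1.continuous.comp (by fun_prop))
    fun N => setIntegral_norm_horizontal_le hσ hF hint z N

/-- A Bernstein-type bound by the same duality: with `s` the conjugate phase of `F'`, the derivative
of the average at `0` is `∫ ‖F'‖` over the window, and Cauchy's estimate on the unit circle bounds
it independently of `N`. -/
lemma IsEntireOfExpType.integrable_deriv (hσ : 0 ≤ σ) (hF : IsEntireOfExpType σ F)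
    (hint : Integrable (fun x : ℝ => F x)) : Integrable (fun x : ℝ => _root_.deriv F x) := by
  have hc : Continuous fun t : ℝ => _root_.deriv F t :=
    hF.1.deriv.continuous.comp (by fun_prop)
  refine integrable_of_bound_on_Icc (B := (∫ x : ℝ, ‖F x‖) * Real.exp σ) hc fun N => ?_
  have hs := measurable_phaseInv.comp hc.measurable
  have hs1 : ∀ t : ℝ, ‖(phaseInv ∘ fun t : ℝ => _root_.deriv F t) t‖ ≤ 1 :=
    fun t => norm_phaseInv_le _
  have h1 := hasDerivAt_weightedAverage hF.1 hs hs1 N 0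
  have h2 := Complex.norm_deriv_le_of_forall_mem_sphere_norm_le (c := 0) (R := 1)
    (C := (∫ x : ℝ, ‖F x‖) * Real.exp σ) one_pos
    (isEntireOfExpType_weightedAverage hσ hF hs hs1 N).1.diffContOnCl
    (fun w hw => (norm_weightedAverage_le hσ hF hint hs hs1 N w).trans ?_)
  · rw [h1.deriv, weightedAverage, div_one] at h2
    simp only [zero_add, Function.comp, mul_phaseInv] at h2
    rw [integral_complex_ofReal, Complex.norm_real] at h2
    exact (le_abs_self _).trans h2
  · have : |w.im| ≤ 1 := by
      have h3 : ‖w‖ = 1 := by simpa using hw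
      exact h3 ▸ Complex.abs_im_le_norm w
    have h4 : 0 ≤ ∫ x : ℝ, ‖F x‖ := by positivity
    gcongr
    nlinarith

end ExponentialType

end TruncatedGaussian


/-! ### Paley–Wiener: vanishing of the Fourier transform beyond the type -/

namespace TruncatedGaussian

section PaleyWiener

open scoped FourierTransform

variable {σ : ℝ} {F : ℂ → ℂ}

lemma hasDerivAt_horizontal (hF : Differentiable ℂ F) (z : ℂ) (t : ℝ) :
    HasDerivAt (fun t : ℝ => F (z + t)) (deriv F (z + t)) t := by
  have h1 : HasDerivAt (fun w : ℂ => F (z + w)) (deriv F (z + t)) (t : ℂ) :=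
    (hF (z + t)).hasDerivAt.comp_const_add z (t : ℂ)
  exact h1.comp_ofReal

lemma deriv_comp_add_right (F : ℂ → ℂ) (z w : ℂ) : deriv (fun u => F (u + z)) w = deriv F (z + w) := by
  rw [deriv_comp_add_const, add_comm]

lemma IsEntireOfExpType.integrable_deriv_horizontal (hσ : 0 ≤ σ) (hF : IsEntireOfExpType σ F)
    (hint : Integrable (fun x : ℝ => F x)) (z : ℂ) :
    Integrable (fun t : ℝ => _root_.deriv F (z + t)) := by
  have h := (hF.comp_add hσ z).integrable_deriv hσ
    (by simpa only [add_comm] using hF.integrable_horizontal hσ hint z)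
  simpa only [deriv_comp_add_right] using h

/-- Both the function and its derivative are integrable along the line. This decay kills the
vertical sides of the contour below. -/
lemma IsEntireOfExpType.tendsto_horizontal_atTop (hσ : 0 ≤ σ) (hF : IsEntireOfExpType σ F)
    (hint : Integrable (fun x : ℝ => F x)) (z : ℂ) :
    Tendsto (fun t : ℝ => F (z + t)) atTop (𝓝 0) :=
  tendsto_zero_of_hasDerivAt_of_integrableOn_Ioi (a := 0)
    (fun t _ => hasDerivAt_horizontal hF.1 z t)
    (hF.integrable_deriv_horizontal hσ hint z).integrableOn
    (hF.integrable_horizontal hσ hint z).integrableOn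

lemma IsEntireOfExpType.tendsto_horizontal_atBot (hσ : 0 ≤ σ) (hF : IsEntireOfExpType σ F)
    (hint : Integrable (fun x : ℝ => F x)) (z : ℂ) :
    Tendsto (fun t : ℝ => F (z + t)) atBot (𝓝 0) :=
  tendsto_zero_of_hasDerivAt_of_integrableOn_Iic (a := 0)
    (fun t _ => hasDerivAt_horizontal hF.1 z t)
    (hF.integrable_deriv_horizontal hσ hint z).integrableOn
    (hF.integrable_horizontal hσ hint z).integrableOn

lemma IsEntireOfExpType.norm_le_integral_deriv (hσ : 0 ≤ σ) (hF : IsEntireOfExpType σ F)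
    (hint : Integrable (fun x : ℝ => F x)) (x : ℝ) :
    ‖F x‖ ≤ ∫ t : ℝ, ‖_root_.deriv F t‖ := by
  have hd := hF.integrable_deriv hσ hint
  have ht := hF.tendsto_horizontal_atBot hσ hint 0
  simp only [zero_add] at ht
  have := integral_Iic_of_hasDerivAt_of_tendsto (f := fun t : ℝ => F t) (a := x)
    (hF.1.continuous.comp Complex.continuous_ofReal).continuousWithinAt
    (fun t _ => by simpa using hasDerivAt_horizontal hF.1 0 t) hd.integrableOn ht
  rw [sub_zero] at this
  rw [← this]
  exact (norm_integral_le_integral_norm _).trans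
    (setIntegral_le_integral hd.norm (Eventually.of_forall fun t => norm_nonneg _))

/-- Moving the contour down to `Im z = -Y` multiplies the exponential by `exp (-2πξY)`, while the
`L¹` norm of `F` grows at most by `exp (2πY)`; for `ξ > 1` the product tends to `0`. -/
lemma IsEntireOfExpType.fourier_eq_zero_of_one_lt (hF : IsEntireOfExpType (2 * Real.pi) F)
    (hint : Integrable (fun x : ℝ => F x)) {ξ : ℝ} (hξ : 1 < ξ) :
    𝓕 (fun x : ℝ => F x) ξ = 0 := by
  have hσ : 0 ≤ 2 * Real.pi := by positivity
  set g : ℂ → ℂ := fun z => Complex.exp (-(2 * Real.pi * ξ : ℝ) * Complex.I * z) * F z with hg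
  have hgd : Differentiable ℂ g := by
    have := hF.1
    rw [hg]; fun_prop
  have hgn : ∀ z, ‖g z‖ = Real.exp (2 * Real.pi * ξ * z.im) * ‖F z‖ := by
    intro z
    rw [hg]
    simp only [norm_mul, Complex.norm_exp]
    congr 2
    simp
  have hgi : ∀ y : ℝ, Integrable (fun x : ℝ => g (x + y * Complex.I)) := by
    intro y
    have h1 := hF.integrable_horizontal hσ hint (y * Complex.I)
    refine (h1.const_mul (Real.exp (2 * Real.pi * ξ * y) : ℂ)).mono
      (hgd.continuous.comp (by fun_prop)).aestronglyMeasurable (Eventually.of_forall fun x => ?_)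
    rw [hgn, norm_mul, Complex.norm_real, Real.norm_of_nonneg (Real.exp_pos _).le, add_comm]
    simp
  obtain ⟨B, hB⟩ : ∃ B, ∀ x : ℝ, ‖F x‖ ≤ B := ⟨_, hF.norm_le_integral_deriv hσ hint⟩
  have shift : ∀ Y : ℝ, 0 ≤ Y → ∫ x : ℝ, g x = ∫ x : ℝ, g (x + (-Y : ℝ) * Complex.I) := by
    intro Y hY
    -- Vertical sides: pointwise decay along horizontals, dominated on the strip because `F` is
    -- bounded on `ℝ`.
    have vert : ∀ a : ℕ → ℝ, (∀ y : ℝ, Tendsto (fun N => F (y * Complex.I + a N)) atTop (𝓝 0)) →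
        Tendsto (fun N => ∫ y in (-Y)..0, g (a N + y * Complex.I)) atTop (𝓝 0) := by
      intro a ha
      have := intervalIntegral.tendsto_integral_filter_of_dominated_convergence (μ := volume)
        (a := -Y) (b := 0) (l := atTop) (F := fun (N : ℕ) (y : ℝ) => g (a N + y * Complex.I))
        (f := fun _ => (0 : ℂ)) (fun _ => B * Real.exp (2 * Real.pi * Y))
        (Eventually.of_forall fun N =>
          (hgd.continuous.comp (by fun_prop : Continuous fun y : ℝ =>
            ((a N : ℂ) + y * Complex.I))).aestronglyMeasurable)
        (Eventually.of_forall fun N => Eventually.of_forall fun y hy => ?_) (by simp)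
        (Eventually.of_forall fun y hy => ?_)
      · simpa using this
      · rw [Set.uIoc_of_le (by linarith)] at hy
        have h1 := hF.norm_le_of_bounded_on_real hσ hB (a N + y * Complex.I)
        have him : ((a N : ℂ) + y * Complex.I).im = y := by simp
        rw [hgn, him]
        rw [him, abs_of_nonpos hy.2] at h1
        have hB0 : 0 ≤ B := (norm_nonneg _).trans (hB 0)
        have h2 : Real.exp (2 * Real.pi * ξ * y) ≤ 1 := by
          rw [Real.exp_le_one_iff]
          have := Real.pi_pos
          exact mul_nonpos_of_nonneg_of_nonpos (by positivity) hy.2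
        calc _ ≤ 1 * ‖F (a N + y * Complex.I)‖ := by gcongr
          _ ≤ _ := by
            rw [one_mul]
            refine h1.trans ?_
            gcongr
            linarith [hy.1]
      · rw [tendsto_zero_iff_norm_tendsto_zero]
        have := ((ha y).norm).const_mul (Real.exp (2 * Real.pi * ξ * y))
        simp only [norm_zero, mul_zero] at this
        refine this.congr fun N => ?_
        rw [hgn, add_comm]
        simp
    have e := fun N : ℕ => Complex.integral_boundary_rect_eq_zero_of_differentiableOn g
      (-(N : ℝ) + (-Y : ℝ) * Complex.I) ((N : ℝ) + (0 : ℝ) * Complex.I) hgd.differentiableOn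
    have ta : Tendsto (fun N : ℕ => -(N : ℝ)) atTop atBot :=
      tendsto_neg_atTop_atBot.comp tendsto_natCast_atTop_atTop
    have tb : Tendsto (fun N : ℕ => (N : ℝ)) atTop atTop := tendsto_natCast_atTop_atTop
    have l1 := intervalIntegral_tendsto_integral (hgi (-Y)) ta tb
    have l2 := intervalIntegral_tendsto_integral (hgi 0) ta tb
    have l3 := vert (fun N : ℕ => (N : ℝ)) fun y =>
      (hF.tendsto_horizontal_atTop hσ hint (y * Complex.I)).comp tb
    have l4 := vert (fun N : ℕ => -(N : ℝ)) fun y =>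
      (hF.tendsto_horizontal_atBot hσ hint (y * Complex.I)).comp ta
    have l := ((l1.sub l2).add (l3.const_smul Complex.I)).sub (l4.const_smul Complex.I)
    have e' : ∀ N : ℕ, (∫ x in (-(N : ℝ))..N, g (x + (-Y : ℝ) * Complex.I)) -
        (∫ x in (-(N : ℝ))..N, g (x + (0 : ℝ) * Complex.I)) +
        Complex.I • (∫ y in (-Y)..0, g ((N : ℝ) + y * Complex.I)) -
        Complex.I • (∫ y in (-Y)..0, g ((-(N : ℝ) : ℝ) + y * Complex.I)) = 0 := by
      intro N
      have := e N
      simpa using this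
    have := tendsto_nhds_unique (l.congr e') tendsto_const_nhds
    simp only [smul_zero, add_zero, sub_zero] at this
    rw [sub_eq_zero] at this
    rw [this]
    simp
  have bound : ∀ Y : ℝ, 0 ≤ Y →
      ‖∫ x : ℝ, g x‖ ≤ (∫ x : ℝ, ‖F x‖) * Real.exp (-(2 * Real.pi * (ξ - 1) * Y)) := by
    intro Y hY
    rw [shift Y hY]
    refine (norm_integral_le_integral_norm _).trans ?_
    have h1 := hF.integral_norm_horizontal_le hσ hint ((-Y : ℝ) * Complex.I)
    have him : (((-Y : ℝ) : ℂ) * Complex.I).im = -Y := by simp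
    rw [him, abs_neg, abs_of_nonneg hY] at h1
    have h2 : ∀ x : ℝ, ‖g (x + (-Y : ℝ) * Complex.I)‖ =
        Real.exp (-(2 * Real.pi * ξ * Y)) * ‖F ((-Y : ℝ) * Complex.I + x)‖ := by
      intro x
      rw [hgn, add_comm]
      simp
    simp only [h2]
    rw [integral_const_mul]
    calc _ ≤ Real.exp (-(2 * Real.pi * ξ * Y)) *
          ((∫ x : ℝ, ‖F x‖) * Real.exp (2 * Real.pi * Y)) := by gcongr
      _ = (∫ x : ℝ, ‖F x‖) *
          (Real.exp (-(2 * Real.pi * ξ * Y)) * Real.exp (2 * Real.pi * Y)) := by ring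
      _ = _ := by rw [← Real.exp_add]; ring_nf
  have hz : ∫ x : ℝ, g x = 0 := by
    rw [← norm_le_zero_iff]
    have ht : Tendsto (fun Y : ℝ => (∫ x : ℝ, ‖F x‖) *
        Real.exp (-(2 * Real.pi * (ξ - 1) * Y))) atTop (𝓝 ((∫ x : ℝ, ‖F x‖) * 0)) := by
      refine Tendsto.const_mul _ (Real.tendsto_exp_neg_atTop_nhds_zero.comp ?_)
      have := Real.pi_pos
      exact tendsto_id.const_mul_atTop (by nlinarith)
    rw [mul_zero] at ht
    exact ge_of_tendsto ht ((eventually_ge_atTop 0).mono bound)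
  rw [Real.fourier_real_eq_integral_exp_smul, ← hz]
  refine integral_congr_ae (Eventually.of_forall fun x => ?_)
  simp only [hg, smul_eq_mul]
  congr 2
  push_cast
  ring

end PaleyWiener

end TruncatedGaussian


/-! ### Poisson summation and uniqueness -/

namespace TruncatedGaussian

section Poisson

open scoped FourierTransform

variable {F : ℂ → ℂ}

lemma continuous_fourier {f : ℝ → ℂ} (hf : Integrable f) : Continuous (𝓕 f) :=
  VectorFourier.fourierIntegral_continuous Real.continuous_fourierChar
    (by fun_prop : Continuous fun p : ℝ × ℝ => (innerₗ ℝ) p.1 p.2) hf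

lemma fourier_eq_zero_of_tendsto {f : ℝ → ℂ} (hf : Integrable f) {S : Set ℝ} {ξ : ℝ}
    (hξ : ξ ∈ closure S) {c : ℂ} (h : ∀ η ∈ S, 𝓕 f η = c) : 𝓕 f ξ = c :=
  (isClosed_eq (continuous_fourier hf) continuous_const).closure_subset_iff.2 h hξ

lemma fourier_comp_neg (f : ℝ → ℂ) (ξ : ℝ) : 𝓕 (fun x => f (-x)) ξ = 𝓕 f (-ξ) := by
  rw [Real.fourier_real_eq_integral_exp_smul, Real.fourier_real_eq_integral_exp_smul,
    ← integral_neg_eq_self]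
  simp

/-- Continuity of the transform adds the endpoint, which matters because the frequencies `±1` occur
in Poisson summation. -/
lemma IsEntireOfExpType.fourier_eq_zero_of_one_le (hF : IsEntireOfExpType (2 * Real.pi) F)
    (hint : Integrable (fun x : ℝ => F x)) {ξ : ℝ} (hξ : 1 ≤ ξ) :
    𝓕 (fun x : ℝ => F x) ξ = 0 := by
  refine fourier_eq_zero_of_tendsto hint (S := Set.Ioi 1) (by simpa using hξ) fun η hη => ?_
  exact hF.fourier_eq_zero_of_one_lt hint hη

lemma IsEntireOfExpType.fourier_eq_zero_of_one_le_abs (hF : IsEntireOfExpType (2 * Real.pi) F)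
    (hint : Integrable (fun x : ℝ => F x)) {ξ : ℝ} (hξ : 1 ≤ |ξ|) :
    𝓕 (fun x : ℝ => F x) ξ = 0 := by
  rcases le_abs.1 hξ with h | h
  · exact hF.fourier_eq_zero_of_one_le hint h
  · have h1 : Integrable (fun x : ℝ => F (-(x : ℂ))) := by
      have := hint.comp_neg
      simpa using this
    have h2 := hF.comp_neg.fourier_eq_zero_of_one_le h1 h
    have h3 := fourier_comp_neg (fun x : ℝ => F x) (-ξ)
    simp only [Complex.ofReal_neg, neg_neg] at h3
    rw [← h3, h2]

/-- One-dimensional Sobolev bound: compare `f x` with `f u` by the fundamental theorem of calculus,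
then average over `u` in the unit interval `[a, a + 1]`. -/
lemma norm_le_integral_add_integral {f f' : ℝ → ℂ} (hf : ∀ x, HasDerivAt f (f' x) x)
    (hf' : Continuous f') {a b x : ℝ} (hab : a + 1 ≤ b) (hx : x ∈ Set.Icc a b) :
    ‖f x‖ ≤ ∫ t in a..b, (‖f t‖ + ‖f' t‖) := by
  have hfc : Continuous f := continuous_iff_continuousAt.2 fun x => (hf x).continuousAt
  have hab' : a ≤ b := by linarith
  have h1 : ∀ u ∈ Set.Icc a (a + 1), ‖f x‖ ≤ ‖f u‖ + ∫ t in a..b, ‖f' t‖ := by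
    intro u hu
    have h2 : ∫ t in u..x, f' t = f x - f u :=
      intervalIntegral.integral_eq_sub_of_hasDerivAt (fun t _ => hf t)
        (hf'.intervalIntegrable _ _)
    have h3 : ‖∫ t in u..x, f' t‖ ≤ ∫ t in a..b, ‖f' t‖ := by
      refine intervalIntegral.norm_integral_le_abs_integral_norm.trans ?_
      refine (intervalIntegral.abs_integral_mono_interval (c := a) (d := b) ?_
        (Eventually.of_forall fun t => norm_nonneg _)
        (hf'.norm.intervalIntegrable _ _)).trans_eq ?_
      · rw [Set.uIoc_of_le hab']
        exact Set.Ioc_subset_Ioc (le_min hu.1 hx.1) (max_le (hu.2.trans hab) hx.2)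
      · exact abs_of_nonneg
          (intervalIntegral.integral_nonneg hab' fun t _ => norm_nonneg _)
    calc ‖f x‖ = ‖f u + (f x - f u)‖ := by simp
      _ ≤ _ := (norm_add_le _ _).trans (by rw [← h2]; gcongr)
  have h4 := intervalIntegral.integral_mono_on (a := a) (b := a + 1) (by linarith)
    (intervalIntegrable_const (μ := volume) (c := ‖f x‖))
    ((hfc.norm.add continuous_const).intervalIntegrable _ _) h1
  simp only [Pi.add_apply] at h4
  rw [intervalIntegral.integral_add (hfc.norm.intervalIntegrable _ _) intervalIntegrable_const,
    intervalIntegral.integral_const, intervalIntegral.integral_const] at h4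
  simp only [add_sub_cancel_left, smul_eq_mul, one_mul] at h4
  rw [intervalIntegral.integral_add (hfc.norm.intervalIntegrable _ _)
    (hf'.norm.intervalIntegrable _ _)]
  have h5 : ∫ t in a..(a + 1), ‖f t‖ ≤ ∫ t in a..b, ‖f t‖ :=
    intervalIntegral.integral_mono_interval le_rfl (by linarith) hab
      (Eventually.of_forall fun t => norm_nonneg _) (hfc.norm.intervalIntegrable _ _)
  linarith

lemma summable_intervalIntegral_window {g : ℝ → ℝ} (hg : Integrable g) (R : ℕ) :
    Summable fun n : ℤ => ∫ t in (n - R : ℝ)..(n + R), g t := by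
  have h1 : Summable fun n : ℤ => ∑ j ∈ Finset.range (2 * R),
      ∫ t in ((-R + j : ℝ) + n)..((-R + j : ℝ) + n + 1), g t :=
    summable_sum fun j _ => (hg.hasSum_intervalIntegral (-R + j : ℝ)).summable
  refine h1.congr fun n => ?_
  have := intervalIntegral.sum_integral_adjacent_intervals (f := g) (μ := volume)
    (a := fun j : ℕ => (-R + j : ℝ) + n) (n := 2 * R) fun k _ => hg.intervalIntegrable
  have e : ∀ j : ℕ, (-R + (j + 1 : ℕ) : ℝ) + n = (-R + j : ℝ) + n + 1 := by
    intro j; push_cast; ring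
  simp only [e] at this
  rw [this]
  congr 1
  · push_cast; ring
  · push_cast; ring

/-- The sup over a translate of `K` is at most the integral of `‖F‖ + ‖F'‖` over a window, and
windows of fixed length overlap boundedly often. Allowing any `f` dominated by `F` covers
modulations of `F` as well. -/
lemma IsEntireOfExpType.summable_restrict (hF : IsEntireOfExpType (2 * Real.pi) F)
    (hint : Integrable (fun x : ℝ => F x)) {f : C(ℝ, ℂ)} (hf : ∀ x : ℝ, ‖f x‖ ≤ ‖F x‖)
    (K : TopologicalSpace.Compacts ℝ) :
    Summable fun n : ℤ => ‖(f.comp (ContinuousMap.addRight (n : ℝ))).restrict K‖ := by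
  have hd := hF.integrable_deriv (by positivity) hint
  obtain ⟨r, hr⟩ := K.isCompact.isBounded.subset_closedBall 0
  obtain ⟨R, hR⟩ := exists_nat_ge (max r 1)
  have hR1 : (1 : ℝ) ≤ R := (le_max_right _ _).trans hR
  refine Summable.of_nonneg_of_le (fun _ => norm_nonneg _) (fun n => ?_)
    (summable_intervalIntegral_window (hint.norm.add hd.norm) R)
  have hder : ∀ x : ℝ, HasDerivAt (fun t : ℝ => F t) (_root_.deriv F x) x :=
    fun x => by simpa using hasDerivAt_horizontal hF.1 0 x
  rw [ContinuousMap.norm_le]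
  · rintro ⟨x, hx⟩
    have h1 := hr hx
    rw [mem_closedBall_zero_iff, Real.norm_eq_abs] at h1
    have h2 := abs_le.1 (h1.trans ((le_max_left r 1).trans hR))
    refine (hf (x + n)).trans ?_
    exact norm_le_integral_add_integral hder
      (hF.1.deriv.continuous.comp Complex.continuous_ofReal) (by linarith)
      ⟨by linarith [h2.1], by linarith [h2.2]⟩
  · exact intervalIntegral.integral_nonneg (by linarith)
      fun t _ => add_nonneg (norm_nonneg _) (norm_nonneg _)

/-- Poisson summation for integrable entire functions of exponential type `2π`. -/
lemma IsEntireOfExpType.tsum_add_int (hF : IsEntireOfExpType (2 * Real.pi) F)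
    (hint : Integrable (fun x : ℝ => F x)) (x : ℝ) :
    ∑' n : ℤ, F ((x + n : ℝ) : ℂ) = ∫ t : ℝ, F t := by
  let f : C(ℝ, ℂ) := ⟨fun t => F t, hF.1.continuous.comp Complex.continuous_ofReal⟩
  have hz : ∀ n : ℤ, n ≠ 0 → 𝓕 (f : ℝ → ℂ) n = 0 := fun n hn =>
    hF.fourier_eq_zero_of_one_le_abs hint (by exact_mod_cast Int.one_le_abs hn)
  have h := Real.tsum_eq_tsum_fourier (f := f)
    (hF.summable_restrict hint fun x => le_rfl)
    (summable_of_ne_finset_zero (s := {0}) fun n hn => hz n (by simpa using hn)) x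
  refine h.trans ((tsum_eq_single 0 fun n hn => by rw [hz n hn, zero_mul]).trans ?_)
  rw [Real.fourier_real_eq_integral_exp_smul]
  simp [f]

lemma IsEntireOfExpType.summable_add_int (hF : IsEntireOfExpType (2 * Real.pi) F)
    (hint : Integrable (fun x : ℝ => F x)) (x : ℝ) :
    Summable fun n : ℤ => F ((x + n : ℝ) : ℂ) := by
  let f : C(ℝ, ℂ) := ⟨fun t => F t, hF.1.continuous.comp Complex.continuous_ofReal⟩
  have h := hF.summable_restrict hint (f := f) (fun x => le_rfl) ⟨{x}, isCompact_singleton⟩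
  refine Summable.of_norm_bounded h fun n => ?_
  exact ((f.comp (ContinuousMap.addRight (n : ℝ))).restrict {x}).norm_coe_le_norm ⟨x, rfl⟩

/-- Poisson summation for the modulated function. The transform is supported in `[-1, 1]`, so among
the points `ξ + n` only `ξ` and `ξ - 1` contribute. -/
lemma IsEntireOfExpType.tsum_int_mul_exp (hF : IsEntireOfExpType (2 * Real.pi) F)
    (hint : Integrable (fun x : ℝ => F x)) {ξ : ℝ} (h0 : 0 < ξ) (h1 : ξ < 1) :
    ∑' n : ℤ, Complex.exp ((-2 * Real.pi * n * ξ : ℝ) * Complex.I) * F ((n : ℝ) : ℂ) =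
      𝓕 (fun x : ℝ => F x) ξ + 𝓕 (fun x : ℝ => F x) (ξ - 1) := by
  let f : C(ℝ, ℂ) := ⟨fun t => Complex.exp ((-2 * Real.pi * t * ξ : ℝ) * Complex.I) * F t,
    (by fun_prop : Continuous fun t : ℝ =>
      Complex.exp ((-2 * Real.pi * t * ξ : ℝ) * Complex.I)).mul
      (hF.1.continuous.comp Complex.continuous_ofReal)⟩
  have hn : ∀ t : ℝ, ‖f t‖ ≤ ‖F t‖ := by
    intro t
    simp only [f, ContinuousMap.coe_mk, norm_mul, Complex.norm_exp_ofReal_mul_I, one_mul, le_rfl]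
  have hf : ∀ η : ℝ, 𝓕 (f : ℝ → ℂ) η = 𝓕 (fun x : ℝ => F x) (ξ + η) := by
    intro η
    rw [Real.fourier_real_eq_integral_exp_smul, Real.fourier_real_eq_integral_exp_smul]
    refine integral_congr_ae (Eventually.of_forall fun t => ?_)
    simp only [f, ContinuousMap.coe_mk, smul_eq_mul]
    rw [← mul_assoc, ← Complex.exp_add]
    congr 2
    push_cast
    ring
  have hz : ∀ n : ℤ, n ∉ ({0, -1} : Finset ℤ) → 𝓕 (f : ℝ → ℂ) n = 0 := by
    intro n hn
    rw [hf]
    refine hF.fourier_eq_zero_of_one_le_abs hint ?_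
    simp only [Finset.mem_insert, Finset.mem_singleton, not_or] at hn
    rcases lt_or_gt_of_ne hn.1 with h | h
    · have : n ≤ -2 := by have := hn.2; omega
      have : (n : ℝ) ≤ -2 := by exact_mod_cast this
      exact le_abs.2 (Or.inr (by linarith))
    · have : (1 : ℝ) ≤ n := by exact_mod_cast h
      exact le_abs.2 (Or.inl (by linarith))
  have h := Real.tsum_eq_tsum_fourier (f := f) (hF.summable_restrict hint hn)
    (summable_of_ne_finset_zero (s := {0, -1}) hz) 0
  have h2 := h.trans (tsum_eq_sum (s := {0, -1}) fun n hn => by rw [hz n hn, zero_mul])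
  rw [Finset.sum_pair (by norm_num)] at h2
  simp only [hf, zero_add] at h2
  simp only [f, ContinuousMap.coe_mk] at h2
  rw [h2]
  simp [sub_eq_add_neg]

/-- An integrable entire function of exponential type `2π` with double zeros at the nonzero integers
and a zero at the origin vanishes identically. -/
lemma IsEntireOfExpType.eq_zero_of_double_zeros (hF : IsEntireOfExpType (2 * Real.pi) F)
    (hint : Integrable (fun x : ℝ => F x)) (h0 : ∀ n : ℤ, F ((n : ℝ) : ℂ) = 0)
    (h1 : ∀ n : ℤ, n ≠ 0 → _root_.deriv F ((n : ℝ) : ℂ) = 0) : F = 0 := by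
  have hσ : 0 ≤ 2 * Real.pi := by positivity
  have hd := hF.integrable_deriv hσ hint
  set f : ℝ → ℂ := fun x => F x with hf
  set c : ℂ := _root_.deriv F 0 with hc
  have hder : ∀ x : ℝ, HasDerivAt f (_root_.deriv F x) x :=
    fun x => by simpa using hasDerivAt_horizontal hF.1 0 x
  have hfd : 𝓕 (fun x : ℝ => _root_.deriv F x) = fun ξ : ℝ => (2 * Real.pi * Complex.I * ξ) • 𝓕 f ξ := by
    have e : _root_.deriv f = fun x : ℝ => _root_.deriv F x := funext fun x => (hder x).deriv
    have := Real.fourier_deriv hint (fun x => (hder x).differentiableAt) (by rwa [e])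
    rwa [e] at this
  -- First equation, from the zeros of `F`: the transform changes sign under `ξ ↦ ξ - 1`.
  have sum0 : ∀ ξ : ℝ, 0 < ξ → ξ < 1 → 𝓕 f ξ + 𝓕 f (ξ - 1) = 0 := by
    intro ξ a b
    rw [← hF.tsum_int_mul_exp hint a b]
    simp only [h0, mul_zero, tsum_zero]
  -- Second equation, from `F'`, of which only the term at `0` survives: `c = 2πi (ξ 𝓕f(ξ) + (ξ - 1)
  -- 𝓕f(ξ - 1))`. With the first equation the right side is `2πi 𝓕f(ξ)`, so the transform is
  -- constant on `(0, 1)`.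
  have sum1 : ∀ ξ : ℝ, 0 < ξ → ξ < 1 → 𝓕 f ξ = c / (2 * Real.pi * Complex.I) := by
    intro ξ a b
    have h2 := (hF.deriv hσ).tsum_int_mul_exp hd a b
    rw [tsum_eq_single 0 fun n hn => by rw [h1 n hn, mul_zero], hfd] at h2
    have h3 := sum0 ξ a b
    have hpi : (2 * Real.pi * Complex.I : ℂ) ≠ 0 := Complex.two_pi_I_ne_zero
    rw [eq_div_iff hpi]
    simp only [smul_eq_mul] at h2
    push_cast at h2
    simp only [mul_zero, zero_mul, Complex.exp_zero, one_mul] at h2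
    rw [eq_neg_of_add_eq_zero_right h3] at h2
    rw [hc, h2]
    ring
  have hcl0 : (0 : ℝ) ∈ closure (Set.Ioo (0 : ℝ) 1) := by
    rw [closure_Ioo (by norm_num)]; simp
  have hzero : 𝓕 f 0 = 0 := by
    have := hF.tsum_add_int hint 0
    rw [Real.fourier_real_eq_integral_exp_smul]
    simp only [zero_add, h0, tsum_zero] at this
    simp [hf, ← this]
  -- The constant extends continuously to `ξ = 0`, where the transform is `∫ F = ∑ F(n) = 0`.
  have hc0 : c / (2 * Real.pi * Complex.I) = 0 := by
    rw [← hzero]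
    exact (fourier_eq_zero_of_tendsto hint hcl0 fun η hη => sum1 η hη.1 hη.2).symm
  rw [hc0] at sum1
  have hall : 𝓕 f = 0 := by
    funext ξ
    rw [Pi.zero_apply]
    rcases le_or_gt 1 |ξ| with h | h
    · exact hF.fourier_eq_zero_of_one_le_abs hint h
    · rw [abs_lt] at h
      rcases lt_trichotomy ξ 0 with h2 | h2 | h2
      · have h3 := sum0 (ξ + 1) (by linarith) (by linarith)
        rw [sum1 (ξ + 1) (by linarith) (by linarith), zero_add, add_sub_cancel_right] at h3
        exact h3
      · rw [h2, hzero]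
      · exact sum1 ξ h2 h.2
  have hreal : ∀ x : ℝ, F x = 0 := by
    intro x
    have := hint.fourierInv_fourier_eq (v := x) (by rw [hall]; exact integrable_zero _ _ _)
      (hder x).continuousAt
    rw [hall, Real.fourierInv_eq'] at this
    simpa using this.symm
  refine AnalyticOnNhd.eq_of_frequently_eq (z₀ := 0)
    (fun z _ => hF.1.analyticAt z) (fun z _ => analyticAt_const) ?_
  have ht : Tendsto (fun n : ℕ => ((1 / ((n : ℝ) + 1) : ℝ) : ℂ)) atTop (𝓝[≠] 0) := by
    refine tendsto_nhdsWithin_iff.2 ⟨?_, Eventually.of_forall fun n => ?_⟩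
    · exact_mod_cast (Complex.continuous_ofReal.tendsto 0).comp tendsto_one_div_add_atTop_nhds_zero_nat
    · have : (1 / ((n : ℝ) + 1)) ≠ 0 := by positivity
      exact Complex.ofReal_ne_zero.2 this
  exact ht.frequently (Frequently.of_forall fun n => hreal _)

end Poisson

end TruncatedGaussian


/-! ### Gaussian sums and the theta functional equation -/

namespace TruncatedGaussian

section GaussianSums

/-- Polynomial growth of a real sequence. -/
def PolyGrowth (c : ℕ → ℝ) : Prop := ∃ K : ℝ, ∃ k : ℕ, ∀ n : ℕ, |c n| ≤ K * ((n : ℝ) + 1) ^ k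

/-- The Gaussian sum `∑ c_n exp (-a m²)`, `m = n + 1 ≥ 1`. -/
noncomputable def gsum (c : ℕ → ℝ) (a : ℝ) : ℝ :=
  ∑' n : ℕ, c n * Real.exp (-a * ((n : ℝ) + 1) ^ 2)

variable {c d : ℕ → ℝ} {a : ℝ}

lemma PolyGrowth.of_bounded {K : ℝ} (h : ∀ n, |c n| ≤ K) : PolyGrowth c :=
  ⟨K, 0, fun n => by simpa using h n⟩

lemma PolyGrowth.mul (hc : PolyGrowth c) (hd : PolyGrowth d) : PolyGrowth fun n => c n * d n := by
  obtain ⟨K, k, h⟩ := hc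
  obtain ⟨L, l, g⟩ := hd
  refine ⟨K * L, k + l, fun n => ?_⟩
  rw [abs_mul, pow_add]
  calc _ ≤ (K * ((n : ℝ) + 1) ^ k) * (L * ((n : ℝ) + 1) ^ l) :=
        mul_le_mul (h n) (g n) (abs_nonneg _) ((abs_nonneg _).trans (h n))
    _ = _ := by ring

lemma polyGrowth_pow (k : ℕ) : PolyGrowth fun n => ((n : ℝ) + 1) ^ k :=
  ⟨1, k, fun n => by rw [one_mul, abs_of_nonneg (by positivity)]⟩

lemma summable_pow_mul_gaussian (k : ℕ) (ha : 0 < a) :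
    Summable fun n : ℕ => ((n : ℝ) + 1) ^ k * Real.exp (-a * ((n : ℝ) + 1) ^ 2) := by
  have h := (summable_nat_add_iff 1).2 (Real.summable_pow_mul_exp_neg_nat_mul k ha)
  refine Summable.of_nonneg_of_le (fun n => by positivity) (fun n => ?_) h
  push_cast
  have h1 : (n : ℝ) + 1 ≤ ((n : ℝ) + 1) ^ 2 := by
    have : (0 : ℝ) ≤ n := n.cast_nonneg
    nlinarith
  have h2 : -a * ((n : ℝ) + 1) ^ 2 ≤ -a * ((n : ℝ) + 1) := by nlinarith
  gcongr

lemma PolyGrowth.summable_norm (hc : PolyGrowth c) (ha : 0 < a) :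
    Summable fun n : ℕ => |c n| * Real.exp (-a * ((n : ℝ) + 1) ^ 2) := by
  obtain ⟨K, k, h⟩ := hc
  refine Summable.of_nonneg_of_le (fun n => by positivity) (fun n => ?_)
    ((summable_pow_mul_gaussian k ha).mul_left K)
  rw [← mul_assoc]
  gcongr
  exact h n

lemma PolyGrowth.summable (hc : PolyGrowth c) (ha : 0 < a) :
    Summable fun n : ℕ => c n * Real.exp (-a * ((n : ℝ) + 1) ^ 2) := by
  refine Summable.of_norm ((hc.summable_norm ha).congr fun n => ?_)
  rw [Real.norm_eq_abs, abs_mul, Real.abs_exp]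

lemma gsum_add (hc : PolyGrowth c) (hd : PolyGrowth d) (ha : 0 < a) :
    gsum (fun n => c n + d n) a = gsum c a + gsum d a := by
  rw [gsum, gsum, gsum, ← (hc.summable ha).tsum_add (hd.summable ha)]
  simp only [add_mul]

lemma gsum_sub (hc : PolyGrowth c) (hd : PolyGrowth d) (ha : 0 < a) :
    gsum (fun n => c n - d n) a = gsum c a - gsum d a := by
  rw [gsum, gsum, gsum, ← (hc.summable ha).tsum_sub (hd.summable ha)]
  simp only [sub_mul]

lemma gsum_const_mul (k : ℝ) (c : ℕ → ℝ) (a : ℝ) : gsum (fun n => k * c n) a = k * gsum c a := by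
  rw [gsum, gsum, ← tsum_mul_left]
  simp only [mul_assoc]

lemma gsum_nonneg (h : ∀ n, 0 ≤ c n) (a : ℝ) : 0 ≤ gsum c a :=
  tsum_nonneg fun n => mul_nonneg (h n) (Real.exp_pos _).le

lemma gsum_mono (hc : PolyGrowth c) (hd : PolyGrowth d) (ha : 0 < a) (h : ∀ n, c n ≤ d n) :
    gsum c a ≤ gsum d a :=
  (hc.summable ha).tsum_le_tsum (fun n => by gcongr; exact h n) (hd.summable ha)

lemma hasDerivAt_gsum (hc : PolyGrowth c) (ha : 0 < a) :
    HasDerivAt (gsum c) (-gsum (fun n => ((n : ℝ) + 1) ^ 2 * c n) a) a := by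
  have h2 := (polyGrowth_pow 2).mul hc
  have h := hasDerivAt_tsum_of_isPreconnected
    (g := fun (n : ℕ) (b : ℝ) => c n * Real.exp (-b * ((n : ℝ) + 1) ^ 2))
    (g' := fun (n : ℕ) (b : ℝ) =>
      -(((n : ℝ) + 1) ^ 2 * c n * Real.exp (-b * ((n : ℝ) + 1) ^ 2)))
    (t := Set.Ioi (a / 2)) (y₀ := a) (y := a) (h2.summable_norm (half_pos ha)) isOpen_Ioi
    isPreconnected_Ioi (fun n b _ => ?_) (fun n b hb => ?_) (half_lt_self ha)
    (hc.summable ha) (half_lt_self ha)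
  · rw [tsum_neg] at h
    exact h
  · have h1 : HasDerivAt (fun b : ℝ => -b * ((n : ℝ) + 1) ^ 2) (-1 * ((n : ℝ) + 1) ^ 2) b :=
      (hasDerivAt_id b).neg.mul_const _
    exact ((h1.exp).const_mul (c n)).congr_deriv (by ring)
  · rw [norm_neg, norm_mul, Real.norm_eq_abs, Real.norm_of_nonneg (Real.exp_pos _).le]
    have : a / 2 < b := hb
    gcongr

/-- The moments `∑_{m ≥ 1} m^k exp (-a m²)`. -/
noncomputable def gmoment (k : ℕ) (a : ℝ) : ℝ := gsum (fun n => ((n : ℝ) + 1) ^ k) a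

lemma hasDerivAt_gmoment (k : ℕ) (ha : 0 < a) :
    HasDerivAt (gmoment k) (-gmoment (k + 2) a) a := by
  refine (hasDerivAt_gsum (polyGrowth_pow k) ha).congr_deriv ?_
  simp only [gmoment, ← pow_add, add_comm k 2]

lemma gmoment_nonneg (k : ℕ) (a : ℝ) : 0 ≤ gmoment k a := gsum_nonneg (fun n => by positivity) a

lemma gsum_mul_pow_sub (x y : ℝ) (j k : ℕ) (ha : 0 < a) :
    gsum (fun n => x * ((n : ℝ) + 1) ^ j - y * ((n : ℝ) + 1) ^ k) a =
      x * gmoment j a - y * gmoment k a := by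
  have hk : ∀ (x : ℝ) k, PolyGrowth fun n => x * ((n : ℝ) + 1) ^ k := fun x k =>
    (PolyGrowth.of_bounded (c := fun _ => x) (fun _ => le_rfl)).mul (polyGrowth_pow k)
  rw [gsum_sub (hk x j) (hk y k) ha, gsum_const_mul, gsum_const_mul, gmoment, gmoment]

lemma hasSum_int_exp (ha : 0 < a) :
    HasSum (fun n : ℤ => Real.exp (-a * (n : ℝ) ^ 2)) (1 + 2 * gmoment 0 a) := by
  have hs := summable_pow_mul_gaussian 0 ha
  simp only [pow_zero, one_mul] at hs
  have h1 : HasSum (fun n : ℕ => Real.exp (-a * ((n : ℤ) : ℝ) ^ 2)) (1 + gmoment 0 a) := by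
    rw [← hasSum_nat_add_iff' 1]
    have e : 1 + gmoment 0 a -
        ∑ i ∈ Finset.range 1, Real.exp (-a * (((i : ℕ) : ℤ) : ℝ) ^ 2) = gmoment 0 a := by simp
    rw [e]
    have := hs.hasSum
    simpa [gmoment, gsum] using this
  have h2 : HasSum (fun n : ℕ => Real.exp (-a * ((-((n : ℤ) + 1) : ℤ) : ℝ) ^ 2))
      (gmoment 0 a) := by
    have e : ∀ n : ℕ, ((-((n : ℤ) + 1) : ℤ) : ℝ) ^ 2 = ((n : ℝ) + 1) ^ 2 := fun n => by
      push_cast; ring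
    simp only [e]
    have := hs.hasSum
    simpa [gmoment, gsum] using this
  convert HasSum.of_nat_of_neg_add_one (f := fun n : ℤ => Real.exp (-a * (n : ℝ) ^ 2)) h1 h2
    using 1
  ring

/-- The theta functional equation, normalised so that the duality is `a ↔ π² / a`. -/
lemma sqrt_mul_theta (ha : 0 < a) :
    √a * (1 + 2 * gmoment 0 a) = √Real.pi * (1 + 2 * gmoment 0 (Real.pi ^ 2 / a)) := by
  have hpi := Real.pi_pos
  have h := Real.tsum_exp_neg_mul_int_sq (a := a / Real.pi) (by positivity)
  have e1 : -Real.pi * (a / Real.pi) = -a := by field_simp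
  have e2 : -Real.pi / (a / Real.pi) = -(Real.pi ^ 2 / a) := by field_simp
  rw [e1, e2, (hasSum_int_exp ha).tsum_eq, (hasSum_int_exp (by positivity)).tsum_eq, ← Real.sqrt_eq_rpow, Real.sqrt_div ha.le] at h
  rw [h]
  have : √a ≠ 0 := by positivity
  field_simp

/-- `p(a) = ∑ (2 a m² - 1) exp (-a m²)`. -/
noncomputable def pSum (a : ℝ) : ℝ := 2 * a * gmoment 2 a - gmoment 0 a

/-- `v(a) = ∑ m² (a m² - 3/2) exp (-a m²)`. -/
noncomputable def vSum (a : ℝ) : ℝ := a * gmoment 4 a - 3 / 2 * gmoment 2 a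

/-- `r(a) = ∑ m (a m² - 1) exp (-a m²)`. -/
noncomputable def rSum (a : ℝ) : ℝ := a * gmoment 3 a - gmoment 1 a

lemma hasDerivAt_pSum (ha : 0 < a) : HasDerivAt pSum (-2 * vSum a) a := by
  have h1 := ((hasDerivAt_id a).const_mul 2).mul (hasDerivAt_gmoment 2 ha)
  refine (h1.sub (hasDerivAt_gmoment 0 ha)).congr_deriv ?_
  simp only [vSum, id]
  ring

lemma hasDerivAt_gmoment_dual (k : ℕ) (ha : 0 < a) :
    HasDerivAt (fun b => gmoment k (Real.pi ^ 2 / b))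
      (gmoment (k + 2) (Real.pi ^ 2 / a) * (Real.pi ^ 2 / a ^ 2)) a := by
  have hpi := Real.pi_pos
  have h1 : HasDerivAt (fun b : ℝ => Real.pi ^ 2 / b) (-(Real.pi ^ 2 / a ^ 2)) a := by
    exact ((hasDerivAt_inv ha.ne').const_mul (Real.pi ^ 2)).congr_deriv (by ring)
  exact ((hasDerivAt_gmoment k (a := Real.pi ^ 2 / a) (by positivity)).comp a h1).congr_deriv
    (by ring)

/-- Derivative of the functional equation in `a`. The dual side is a sum of positive terms, which is
what yields `p ≤ 1/2`. -/
lemma one_sub_two_mul_pSum (ha : 0 < a) :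
    a * √a * (1 - 2 * pSum a) = 4 * √Real.pi * Real.pi ^ 2 * gmoment 2 (Real.pi ^ 2 / a) := by
  have hl : HasDerivAt (fun b => √b * (1 + 2 * gmoment 0 b)) _ a :=
    (Real.hasDerivAt_sqrt ha.ne').mul (((hasDerivAt_gmoment 0 ha).const_mul 2).const_add 1)
  have hr : HasDerivAt (fun b => √Real.pi * (1 + 2 * gmoment 0 (Real.pi ^ 2 / b))) _ a :=
    (((hasDerivAt_gmoment_dual 0 ha).const_mul 2).const_add 1).const_mul (√Real.pi)
  have he : (fun b => √b * (1 + 2 * gmoment 0 b)) =ᶠ[𝓝 a]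
      (fun b => √Real.pi * (1 + 2 * gmoment 0 (Real.pi ^ 2 / b))) := by
    filter_upwards [lt_mem_nhds ha] with b hb using sqrt_mul_theta hb
  have h := hl.unique (hr.congr_of_eventuallyEq he)
  have hs : √a * √a = a := Real.mul_self_sqrt ha.le
  have hs0 : √a ≠ 0 := by positivity
  rw [pSum]
  field_simp at h
  have h3 : √a ^ 2 = a := by rw [sq, hs]
  rw [h3] at h
  simp only [Nat.zero_add] at h
  refine mul_left_cancel₀ ha.ne' ?_
  linear_combination √a * h +
    4 * √Real.pi * Real.pi ^ 2 * gmoment 2 (Real.pi ^ 2 / a) * hs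

lemma pSum_le_half (ha : 0 < a) : pSum a ≤ 1 / 2 := by
  have h := one_sub_two_mul_pSum ha
  have h1 : 0 ≤ a * √a * (1 - 2 * pSum a) := by
    rw [h]
    have := gmoment_nonneg 2 (Real.pi ^ 2 / a)
    have := Real.pi_pos
    positivity
  have := nonneg_of_mul_nonneg_right h1 (by positivity)
  linarith

/-- Second derivative of the functional equation. The coefficient `3/2` in `v` comes from
differentiating `a √a`, and with it `v` is self-dual. -/
lemma vSum_dual (ha : 0 < a) :
    a ^ 2 * √a * vSum a = √Real.pi * Real.pi ^ 2 * vSum (Real.pi ^ 2 / a) := by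
  have hl : HasDerivAt (fun b => b * √b * (1 - 2 * pSum b)) _ a :=
    ((hasDerivAt_id a).mul (Real.hasDerivAt_sqrt ha.ne')).mul
      (((hasDerivAt_pSum ha).const_mul 2).const_sub 1)
  have hr : HasDerivAt (fun b => 4 * √Real.pi * Real.pi ^ 2 * gmoment 2 (Real.pi ^ 2 / b)) _ a :=
    (hasDerivAt_gmoment_dual 2 ha).const_mul (4 * √Real.pi * Real.pi ^ 2)
  have he : (fun b => b * √b * (1 - 2 * pSum b)) =ᶠ[𝓝 a]
      (fun b => 4 * √Real.pi * Real.pi ^ 2 * gmoment 2 (Real.pi ^ 2 / b)) := by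
    filter_upwards [lt_mem_nhds ha] with b hb using one_sub_two_mul_pSum hb
  have h := hl.unique (hr.congr_of_eventuallyEq he)
  have h2 := one_sub_two_mul_pSum ha
  have hs : √a * √a = a := Real.mul_self_sqrt ha.le
  have hs0 : √a ≠ 0 := by positivity
  simp only [id, Pi.mul_apply, Nat.reduceAdd] at h
  rw [vSum.eq_1 (Real.pi ^ 2 / a)]
  have h4 : 1 * √a + a * (1 / (2 * √a)) = 3 / 2 * √a := by
    field_simp
    linear_combination -hs
  have h5 : a * (Real.pi ^ 2 / a ^ 2) = Real.pi ^ 2 / a := by field_simp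
  rw [h4] at h
  linear_combination a / 4 * h - 3 / 8 * h2 +
    √Real.pi * Real.pi ^ 2 * gmoment 4 (Real.pi ^ 2 / a) * h5

lemma vSum_nonneg_of_ge (ha : 3 / 2 ≤ a) : 0 ≤ vSum a := by
  have : vSum a = gsum (fun n => a * ((n : ℝ) + 1) ^ 4 - 3 / 2 * ((n : ℝ) + 1) ^ 2) a := by
    rw [gsum_mul_pow_sub _ _ _ _ (by linarith), vSum]
  rw [this]
  refine gsum_nonneg (fun n => ?_) a
  have h1 : (1 : ℝ) ≤ ((n : ℝ) + 1) ^ 2 := one_le_pow₀ (by simp)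
  nlinarith [mul_nonneg (sub_nonneg.2 ha) (by positivity : (0 : ℝ) ≤ ((n : ℝ) + 1) ^ 4)]

/-- The terms are nonnegative once `a ≥ 3/2`. Otherwise the dual point `π² / a` lies in that range,
and `vSum_dual` transfers the sign. -/
lemma vSum_nonneg (ha : 0 < a) : 0 ≤ vSum a := by
  rcases le_or_gt (3 / 2) a with h | h
  · exact vSum_nonneg_of_ge h
  · have hpi := Real.pi_gt_three
    have h1 : 0 ≤ vSum (Real.pi ^ 2 / a) := by
      apply vSum_nonneg_of_ge
      rw [le_div_iff₀ ha]
      nlinarith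
    have h2 : 0 ≤ a ^ 2 * √a * vSum a := by
      rw [vSum_dual ha]
      positivity
    exact nonneg_of_mul_nonneg_right h2 (by positivity)

/-- Since `p' = -2v ≤ 0`, it suffices to go right to `max a 1`, where `2 a m² ≥ 1` makes every term
nonnegative. -/
lemma pSum_nonneg (ha : 0 < a) : 0 ≤ pSum a := by
  have hanti : AntitoneOn pSum (Set.Ioi 0) := by
    refine antitoneOn_of_deriv_nonpos (convex_Ioi 0)
      (fun b hb => (hasDerivAt_pSum hb).continuousAt.continuousWithinAt)
      (fun b hb => (hasDerivAt_pSum (interior_subset hb)).differentiableAt.differentiableWithinAt)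
      fun b hb => ?_
    have hb' : 0 < b := interior_subset hb
    rw [(hasDerivAt_pSum hb').deriv]
    linarith [vSum_nonneg hb']
  have h1 : 0 ≤ pSum (max a 1) := by
    have hb : 1 ≤ max a 1 := le_max_right _ _
    have : pSum (max a 1) = gsum (fun n => (2 * max a 1) * ((n : ℝ) + 1) ^ 2
        - 1 * ((n : ℝ) + 1) ^ 0) (max a 1) := by
      rw [gsum_mul_pow_sub _ _ _ _ (by linarith), pSum]
      ring
    rw [this]
    refine gsum_nonneg (fun n => ?_) _
    have h1 : (1 : ℝ) ≤ ((n : ℝ) + 1) ^ 2 := one_le_pow₀ (by simp)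
    nlinarith
  exact h1.trans (hanti ha (lt_max_of_lt_left ha) (le_max_left _ _))

end GaussianSums

end TruncatedGaussian


/-! ### Sign of `rSum`, and telescoping estimates for Gaussian sums -/

namespace TruncatedGaussian

section GaussianSumBounds

variable {a : ℝ}

lemma PolyGrowth.add {c d : ℕ → ℝ} (hc : PolyGrowth c) (hd : PolyGrowth d) :
    PolyGrowth fun n => c n + d n := by
  obtain ⟨K, k, h⟩ := hc
  obtain ⟨L, l, g⟩ := hd
  refine ⟨|K| + |L|, k + l, fun n => (abs_add_le _ _).trans ?_⟩
  have hn : (1 : ℝ) ≤ (n : ℝ) + 1 := by simp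
  rw [add_mul]
  refine add_le_add ((h n).trans ?_) ((g n).trans ?_)
  · exact mul_le_mul (le_abs_self K) (pow_le_pow_right₀ hn (Nat.le_add_right k l))
      (by positivity) (abs_nonneg K)
  · exact mul_le_mul (le_abs_self L) (pow_le_pow_right₀ hn (Nat.le_add_left l k))
      (by positivity) (abs_nonneg L)

lemma PolyGrowth.const_mul {c : ℕ → ℝ} (k : ℝ) (hc : PolyGrowth c) :
    PolyGrowth fun n => k * c n :=
  (PolyGrowth.of_bounded (c := fun _ => k) (fun _ => le_rfl)).mul hc

lemma PolyGrowth.sub {c d : ℕ → ℝ} (hc : PolyGrowth c) (hd : PolyGrowth d) :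
    PolyGrowth fun n => c n - d n := by
  simpa [sub_eq_add_neg] using hc.add (hd.const_mul (-1))

lemma polyGrowth_affine (x y : ℝ) : PolyGrowth fun n => x + y * (n : ℝ) := by
  have h := (PolyGrowth.of_bounded (c := fun _ => x - y) (fun _ => le_rfl)).add
    ((polyGrowth_pow 1).const_mul y)
  refine (funext fun n => ?_ : (fun n : ℕ => x + y * (n : ℝ)) = _) ▸ h
  ring

lemma integrableOn_rpow_mul_exp {s m : ℝ} (hs : -1 < s) (hm : 0 < m) :
    IntegrableOn (fun x : ℝ => x ^ s * Real.exp (-(m ^ 2 * x))) (Set.Ioi 0) := by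
  have := integrableOn_rpow_mul_exp_neg_mul_rpow (p := 1) hs one_pos (by positivity : 0 < m ^ 2)
  simpa [neg_mul] using this

lemma integral_rpow_neg_half_mul_exp {m : ℝ} (hm : 0 < m) :
    ∫ x in Set.Ioi (0 : ℝ), x ^ (-(1 / 2) : ℝ) * Real.exp (-(m ^ 2 * x)) = √Real.pi / m := by
  have h := Real.integral_rpow_mul_exp_neg_mul_Ioi (a := 1 / 2) (r := m ^ 2) (by norm_num)
    (by positivity)
  rw [Real.Gamma_one_half_eq, ← Real.sqrt_eq_rpow, Real.sqrt_div zero_le_one,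
    Real.sqrt_sq hm.le, Real.sqrt_one] at h
  rw [show (1 / 2 - 1 : ℝ) = -(1 / 2) by norm_num] at h
  rw [h]
  ring

lemma integral_rpow_half_mul_exp {m : ℝ} (hm : 0 < m) :
    ∫ x in Set.Ioi (0 : ℝ), x ^ (1 / 2 : ℝ) * Real.exp (-(m ^ 2 * x)) =
      √Real.pi / (2 * m ^ 3) := by
  have h := Real.integral_rpow_mul_exp_neg_mul_Ioi (a := 3 / 2) (r := m ^ 2) (by norm_num)
    (by positivity)
  rw [show (3 / 2 : ℝ) - 1 = 1 / 2 by norm_num, show (3 / 2 : ℝ) = 1 / 2 + 1 by norm_num,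
    Real.Gamma_add_one (by norm_num), Real.Gamma_one_half_eq, Real.rpow_add_one (by positivity),
    ← Real.sqrt_eq_rpow, Real.sqrt_div zero_le_one, Real.sqrt_sq hm.le, Real.sqrt_one] at h
  rw [h]
  field_simp

lemma vSum_integrand_eq (m a C : ℝ) {s : ℝ} (hs : 0 < s) :
    s ^ (-(1 / 2) : ℝ) * ((m ^ 2 * ((a + s) * m ^ 2 + C)) * Real.exp (-(a + s) * m ^ 2)) =
      m ^ 2 * (a * m ^ 2 + C) * Real.exp (-a * m ^ 2) *
        (s ^ (-(1 / 2) : ℝ) * Real.exp (-(m ^ 2 * s))) +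
      m ^ 4 * Real.exp (-a * m ^ 2) * (s ^ (1 / 2 : ℝ) * Real.exp (-(m ^ 2 * s))) := by
  have e1 : Real.exp (-(a + s) * m ^ 2) = Real.exp (-a * m ^ 2) * Real.exp (-(m ^ 2 * s)) := by
    rw [← Real.exp_add]; ring_nf
  have e2 : s ^ (1 / 2 : ℝ) = s * s ^ (-(1 / 2) : ℝ) := by
    rw [← Real.rpow_one_add' hs.le (by norm_num)]; norm_num
  rw [e1, e2]
  ring

lemma integrableOn_vSum_term (a C : ℝ) {m : ℝ} (hm : 0 < m) :
    IntegrableOn (fun s : ℝ => s ^ (-(1 / 2) : ℝ) *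
      ((m ^ 2 * ((a + s) * m ^ 2 + C)) * Real.exp (-(a + s) * m ^ 2))) (Set.Ioi 0) := by
  refine IntegrableOn.congr_fun ?_ (fun s hs => (vSum_integrand_eq m a C hs).symm)
    measurableSet_Ioi
  exact ((integrableOn_rpow_mul_exp (by norm_num) hm).const_mul _).add
    ((integrableOn_rpow_mul_exp (by norm_num) hm).const_mul _)

/-- Half-order integration of one term. The value `C = -3/2` gives `v` on the left and `r` on the
right; `C = 3/2` serves as a dominating term. -/
lemma integral_vSum_term (a C : ℝ) {m : ℝ} (hm : 0 < m) :
    ∫ s in Set.Ioi (0 : ℝ), s ^ (-(1 / 2) : ℝ) *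
      ((m ^ 2 * ((a + s) * m ^ 2 + C)) * Real.exp (-(a + s) * m ^ 2)) =
      √Real.pi * ((a * m ^ 3 + (C + 1 / 2) * m) * Real.exp (-a * m ^ 2)) := by
  rw [setIntegral_congr_fun measurableSet_Ioi fun s hs => vSum_integrand_eq m a C hs,
    integral_add ((integrableOn_rpow_mul_exp (by norm_num) hm).const_mul _)
      ((integrableOn_rpow_mul_exp (by norm_num) hm).const_mul _),
    integral_const_mul, integral_const_mul, integral_rpow_neg_half_mul_exp hm,
    integral_rpow_half_mul_exp hm]
  field_simp
  ring

/-- Summing the termwise formula gives `√π r(a) = ∫₀^∞ s^(-1/2) v(a + s) ds`, so the sign of `v`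
passes to `r`. -/
lemma rSum_nonneg (ha : 0 < a) : 0 ≤ rSum a := by
  set f : ℕ → ℝ → ℝ := fun n s => s ^ (-(1 / 2) : ℝ) *
    ((((n : ℝ) + 1) ^ 2 * ((a + s) * ((n : ℝ) + 1) ^ 2 + (-(3 / 2)))) *
      Real.exp (-(a + s) * ((n : ℝ) + 1) ^ 2)) with hf
  have hm : ∀ n : ℕ, (0 : ℝ) < (n : ℝ) + 1 := fun n => by positivity
  have hsum : HasSum (fun n => ∫ s in Set.Ioi (0 : ℝ), f n s)
      (∫ s in Set.Ioi (0 : ℝ), ∑' n, f n s) := by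
    refine hasSum_integral_of_summable_integral_norm
      (fun n => integrableOn_vSum_term a (-(3 / 2)) (hm n)) ?_
    have hs : Summable fun n : ℕ =>
        √Real.pi * ((a * ((n : ℝ) + 1) ^ 3 + (3 / 2 + 1 / 2) * ((n : ℝ) + 1)) *
          Real.exp (-a * ((n : ℝ) + 1) ^ 2)) := by
      have h3 := (summable_pow_mul_gaussian 3 ha).mul_left a
      have h1 := (summable_pow_mul_gaussian 1 ha).mul_left (3 / 2 + 1 / 2)
      refine ((h3.add h1).congr fun n => ?_).mul_left _
      ring
    refine Summable.of_nonneg_of_le (fun n => by positivity) (fun n => ?_) hs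
    rw [← integral_vSum_term a (3 / 2) (hm n)]
    refine setIntegral_mono_on (integrableOn_vSum_term a (-(3 / 2)) (hm n)).norm
      (integrableOn_vSum_term a (3 / 2) (hm n)) measurableSet_Ioi fun s hs => ?_
    have hs' : (0 : ℝ) < s := hs
    rw [hf]
    simp only [norm_mul, Real.norm_eq_abs, Real.abs_exp, abs_pow]
    rw [abs_of_nonneg (hm n).le, abs_of_nonneg (Real.rpow_nonneg hs'.le _)]
    gcongr
    rw [abs_le]
    have : 0 ≤ (a + s) * ((n : ℝ) + 1) ^ 2 := by positivity
    constructor <;> linarith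
  have hL : ∑' n, ∫ s in Set.Ioi (0 : ℝ), f n s = √Real.pi * rSum a := by
    simp only [hf, integral_vSum_term a _ (hm _)]
    rw [tsum_mul_left, rSum, ← one_mul (gmoment 1 a), ← gsum_mul_pow_sub a 1 3 1 ha, gsum]
    congr 2
    funext n
    ring
  have hR : 0 ≤ ∫ s in Set.Ioi (0 : ℝ), ∑' n, f n s := by
    refine setIntegral_nonneg measurableSet_Ioi fun s hs => ?_
    have hs' : (0 : ℝ) < s := hs
    have has : 0 < a + s := by linarith
    rw [hf]
    simp only
    rw [tsum_mul_left]
    refine mul_nonneg (Real.rpow_nonneg hs'.le _) ?_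
    have h := vSum_nonneg has
    rw [vSum, ← gsum_mul_pow_sub _ _ _ _ has, gsum] at h
    refine h.trans_eq (tsum_congr fun n => ?_)
    ring
  rw [← hsum.tsum_eq, hL] at hR
  exact nonneg_of_mul_nonneg_right hR (by have := Real.pi_pos; positivity)

/-- With `q n = exp (-a n²)` and `m = n + 1`, `q n - q (n + 2) = 2 exp (-a) exp (-a m²) sinh (2 a
m)`. Using `x ≤ sinh x` and telescoping gives the bound, whose right side tends to the exact limit
`2` as `a → 0⁺`. -/
lemma mul_gmoment_one_le (ha : 0 < a) : 4 * a * gmoment 1 a ≤ Real.exp a + 1 := by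
  set q : ℕ → ℝ := fun n => Real.exp (-a * (n : ℝ) ^ 2) with hq
  have hs1 : Summable fun n => q (n + 1) := by
    have := summable_pow_mul_gaussian 0 ha
    simpa [hq] using this
  have hs : Summable q := (summable_nat_add_iff 1).1 hs1
  have hs2 : Summable fun n => q (n + 2) := (summable_nat_add_iff 2).2 hs
  have htel : ∑' n, (q n - q (n + 2)) = 1 + Real.exp (-a) := by
    rw [hs.tsum_sub hs2, ← hs.sum_add_tsum_nat_add 2]
    simp [Finset.sum_range_succ, hq]
  have hle : 4 * a * Real.exp (-a) * gmoment 1 a ≤ 1 + Real.exp (-a) := by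
    rw [← htel, gmoment, gsum, ← tsum_mul_left]
    refine Summable.tsum_le_tsum (fun n => ?_)
      ((summable_pow_mul_gaussian 1 ha).mul_left _) (hs.sub hs2)
    have e1 : q n = Real.exp (-a) * Real.exp (-a * ((n : ℝ) + 1) ^ 2) *
        Real.exp (2 * a * ((n : ℝ) + 1)) := by
      rw [hq, ← Real.exp_add, ← Real.exp_add]
      ring_nf
    have e2 : q (n + 2) = Real.exp (-a) * Real.exp (-a * ((n : ℝ) + 1) ^ 2) *
        Real.exp (-(2 * a * ((n : ℝ) + 1))) := by
      rw [hq, ← Real.exp_add, ← Real.exp_add]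
      push_cast
      ring_nf
    rw [e1, e2, ← mul_sub, pow_one]
    have h2 : 2 * (2 * a * ((n : ℝ) + 1)) ≤ Real.exp (2 * a * ((n : ℝ) + 1)) -
        Real.exp (-(2 * a * ((n : ℝ) + 1))) := by
      have h := Real.self_le_sinh_iff.2 (by positivity : 0 ≤ 2 * a * ((n : ℝ) + 1))
      rw [Real.sinh_eq] at h
      linarith
    calc _ = Real.exp (-a) * Real.exp (-a * ((n : ℝ) + 1) ^ 2) *
          (2 * (2 * a * ((n : ℝ) + 1))) := by ring
      _ ≤ _ := by gcongr
  have e : Real.exp a * Real.exp (-a) = 1 := by rw [← Real.exp_add]; simp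
  have := mul_le_mul_of_nonneg_left hle (Real.exp_pos a).le
  calc 4 * a * gmoment 1 a = Real.exp a * (4 * a * Real.exp (-a) * gmoment 1 a) := by
        linear_combination (-(4 * a * gmoment 1 a)) * e
    _ ≤ _ := this
    _ = _ := by linear_combination e

lemma gmoment_zero_le_one (ha : 0 < a) : gmoment 0 a ≤ gmoment 1 a :=
  gsum_mono (polyGrowth_pow 0) (polyGrowth_pow 1) ha fun n => by simp

lemma one_sub_exp_neg_le {x : ℝ} (hx : 0 ≤ x) :
    1 - Real.exp (-x) ≤ x / 2 * (1 + Real.exp (-x)) := by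
  set f : ℝ → ℝ := fun x => x / 2 * (1 + Real.exp (-x)) + Real.exp (-x) with hf
  have hd : ∀ y, HasDerivAt f (1 / 2 * (1 - Real.exp (-y) * (1 + y))) y := by
    intro y
    have h1 : HasDerivAt (fun y : ℝ => Real.exp (-y)) (Real.exp (-y) * -1) y :=
      (hasDerivAt_id y).neg.exp
    exact ((((hasDerivAt_id y).div_const 2).mul (h1.const_add 1)).add h1).congr_deriv
      (by simp only [id]; ring)
  have hmono : Monotone f := by
    refine monotone_of_deriv_nonneg (fun y => (hd y).differentiableAt) fun y => ?_
    rw [(hd y).deriv]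
    have h1 : Real.exp (-y) * (1 + y) ≤ Real.exp (-y) * Real.exp y := by
      gcongr
      rw [add_comm]
      exact Real.add_one_le_exp y
    rw [← Real.exp_add, neg_add_cancel, Real.exp_zero] at h1
    linarith
  have := hmono hx
  simp only [hf, neg_zero, Real.exp_zero] at this
  linarith

/-- Telescoping lower bound coming from `1 - exp (-x) ≤ x / 2 * (1 + exp (-x))`. -/
lemma le_gsum_of_weights (ha : 0 < a) {w : ℕ → ℝ} (hw : PolyGrowth w) (hw0 : ∀ n, 0 ≤ w n)
    (hw1 : PolyGrowth fun n => w (n + 1)) :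
    w 0 * (1 - a / 2) ≤ gsum (fun n => w n * (1 + a * ((n : ℝ) + 1 / 2)) -
      w (n + 1) * (1 - a * ((n : ℝ) + 3 / 2))) a := by
  set q : ℕ → ℝ := fun n => Real.exp (-a * (n : ℝ) ^ 2) with hq
  have hu := hw.mul (polyGrowth_affine (1 + a * (1 / 2)) a)
  have hv := hw1.mul (polyGrowth_affine (1 - a * (3 / 2)) (-a))
  have hus : Summable fun n => w n * (1 + a * ((n : ℝ) + 1 / 2)) * q (n + 1) := by
    refine (hu.summable ha).congr fun n => ?_
    simp only [hq]
    push_cast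
    ring
  have hvs1 : Summable fun n => w (n + 1) * (1 - a * ((n : ℝ) + 3 / 2)) * q (n + 1) := by
    refine (hv.summable ha).congr fun n => ?_
    simp only [hq]
    push_cast
    ring
  have hvs : Summable fun n => w n * (1 - a * ((n : ℝ) + 1 / 2)) * q n := by
    rw [← summable_nat_add_iff 1]
    refine hvs1.congr fun n => ?_
    push_cast
    ring
  -- The inequality `1 - exp (-x) ≤ x / 2 * (1 + exp (-x))` at `x = a (2n + 1)`, the exponent gap
  -- between `q n` and `q (n + 1)`. Shifting the index on the left afterwards isolates the boundary
  -- term `w 0 * (1 - a / 2)`.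
  have hle : ∑' n, w n * (1 - a * ((n : ℝ) + 1 / 2)) * q n ≤
      ∑' n, w n * (1 + a * ((n : ℝ) + 1 / 2)) * q (n + 1) := by
    refine hvs.tsum_le_tsum (fun n => ?_) hus
    have e : q (n + 1) = q n * Real.exp (-(a * (2 * n + 1))) := by
      simp only [hq]
      rw [← Real.exp_add]
      push_cast
      ring_nf
    have h1 := one_sub_exp_neg_le (by positivity : 0 ≤ a * (2 * (n : ℝ) + 1))
    rw [e, mul_assoc, mul_assoc]
    refine mul_le_mul_of_nonneg_left ?_ (hw0 n)
    have h2 : 0 < q n := Real.exp_pos _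
    nlinarith
  rw [hvs.tsum_eq_zero_add] at hle
  have e1 : gsum (fun n => w n * (1 + a * ((n : ℝ) + 1 / 2)) -
      w (n + 1) * (1 - a * ((n : ℝ) + 3 / 2))) a =
      ∑' n, w n * (1 + a * ((n : ℝ) + 1 / 2)) * q (n + 1) -
      ∑' n, w (n + 1) * (1 - a * ((n : ℝ) + 3 / 2)) * q (n + 1) := by
    rw [← hus.tsum_sub hvs1, gsum]
    refine tsum_congr fun n => ?_
    simp only [hq]
    push_cast
    ring
  have e2 : ∑' n : ℕ, w (n + 1) * (1 - a * (((n + 1 : ℕ) : ℝ) + 1 / 2)) * q (n + 1) =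
      ∑' n : ℕ, w (n + 1) * (1 - a * ((n : ℝ) + 3 / 2)) * q (n + 1) := by
    refine tsum_congr fun n => ?_
    push_cast
    ring
  rw [e1, ← e2]
  simp only [hq, Nat.cast_zero] at hle ⊢
  norm_num at hle ⊢
  linarith

/-- The interpolation series is nonpositive to the left of the origin, as a statement about its product with `-b` at `-b`. -/
lemma gsum_left_nonneg (ha : 0 < a) {b : ℝ} (hb : 0 < b) :
    0 ≤ gsum (fun n => 2 * a * ((n : ℝ) + 1) ^ 2 / (b + (n + 1)) - b / (b + (n + 1)) ^ 2) a := by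
  -- With `m = n + 1`, a term is nonnegative iff `b ≤ 2 a m² (b + m)`, and `m = 1` is the worst
  -- case. In the remaining case `a < 1/2`.
  rcases le_or_gt b (2 * a * (b + 1)) with h | h
  · refine gsum_nonneg (fun n => ?_) a
    have hn : (0 : ℝ) ≤ n := n.cast_nonneg
    have hc : 0 < b + (n + 1) := by positivity
    rw [sub_nonneg, div_le_div_iff₀ (by positivity) hc]
    have h1 : b ≤ 2 * a * ((n : ℝ) + 1) ^ 2 * (b + (n + 1)) := by
      have h2 : (1 : ℝ) ≤ ((n : ℝ) + 1) ^ 2 := one_le_pow₀ (by linarith)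
      calc b ≤ 2 * a * 1 * (b + 1) := by linarith
        _ ≤ _ := by gcongr; linarith
    calc b * (b + (n + 1)) ≤ (2 * a * ((n : ℝ) + 1) ^ 2 * (b + (n + 1))) * (b + (n + 1)) := by
          gcongr
      _ = _ := by ring
  · have ha2 : a < 1 / 2 := by
      by_contra hcon
      nlinarith
    have hS : a * gmoment 0 a ≤ 3 / 4 := by
      have h1 := mul_gmoment_one_le ha
      have h2 := mul_le_mul_of_nonneg_left (gmoment_zero_le_one ha) ha.le
      have h3 : Real.exp a ≤ 2 := by
        have h4 : Real.exp a ≤ Real.exp (1 / 2) := by gcongr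
        have h5 : Real.exp (1 / 2) * Real.exp (1 / 2) = Real.exp 1 := by
          rw [← Real.exp_add]; norm_num
        have h6 := Real.exp_one_lt_d9
        nlinarith [Real.exp_pos (1 / 2)]
      nlinarith
    -- This weight satisfies `w n - w (n + 1) = -b / (c² - 1/4)` with `c = b + n + 1`, so the
    -- telescoped sum reproduces the target terms up to a small error.
    set w : ℕ → ℝ := fun n => ((n : ℝ) + 1 / 2) / (b + n + 1 / 2) with hw
    have hw0 : ∀ n, 0 ≤ w n := fun n => by positivity
    have hw1 : ∀ n, |w n| ≤ 1 := fun n => by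
      rw [abs_of_nonneg (hw0 n), hw]
      exact div_le_one_of_le₀ (by linarith) (by positivity)
    have key := le_gsum_of_weights ha (PolyGrowth.of_bounded hw1) hw0
      (PolyGrowth.of_bounded fun n => hw1 (n + 1))
    have hpg : PolyGrowth fun n : ℕ =>
        2 * a * ((n : ℝ) + 1) ^ 2 / (b + (n + 1)) - b / (b + (n + 1)) ^ 2 := by
      refine ⟨2 * a / b + 1 / b, 2, fun n => ?_⟩
      have hn : (0 : ℝ) ≤ n := n.cast_nonneg
      have h2 : (1 : ℝ) ≤ ((n : ℝ) + 1) ^ 2 := one_le_pow₀ (by linarith)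
      have h3 : 2 * a * ((n : ℝ) + 1) ^ 2 / (b + (n + 1)) ≤ 2 * a * ((n : ℝ) + 1) ^ 2 / b := by
        gcongr
        linarith
      have h4 : b / (b + (n + 1)) ^ 2 ≤ 1 / b := by
        rw [div_le_div_iff₀ (by positivity) hb]
        nlinarith
      have h5 : 0 ≤ 2 * a * ((n : ℝ) + 1) ^ 2 / (b + (n + 1)) := by positivity
      have h6 : 0 ≤ b / (b + (n + 1)) ^ 2 := by positivity
      have h7 : 1 / b ≤ 1 / b * ((n : ℝ) + 1) ^ 2 := le_mul_of_one_le_right (by positivity) h2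
      have h8 : (2 * a / b + 1 / b) * ((n : ℝ) + 1) ^ 2 =
        2 * a * ((n : ℝ) + 1) ^ 2 / b + 1 / b * ((n : ℝ) + 1) ^ 2 := by ring
      rw [h8, abs_le]
      constructor <;> linarith
    have hκ : PolyGrowth fun n : ℕ => w n * (1 + a * ((n : ℝ) + 1 / 2)) -
        w (n + 1) * (1 - a * ((n : ℝ) + 3 / 2)) := by
      have h1 := (PolyGrowth.of_bounded hw1).mul (polyGrowth_affine (1 + a * (1 / 2)) a)
      have h2 := (PolyGrowth.of_bounded fun n => hw1 (n + 1)).mul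
        (polyGrowth_affine (1 - a * (3 / 2)) (-a))
      convert h1.sub h2 using 2
      ring
    -- A uniform bound for the error term `a b² / (2 c (c² - 1/4))`. Its total `e * gmoment 0 a` is
    -- absorbed by the boundary term, since `a * gmoment 0 a ≤ 3/4` and `a / 2 < 1/4`.
    set e : ℝ := a / (2 * b + 1) with he
    have hcmp : ∀ n : ℕ, w n * (1 + a * ((n : ℝ) + 1 / 2)) -
        w (n + 1) * (1 - a * ((n : ℝ) + 3 / 2)) ≤
        (2 * a * ((n : ℝ) + 1) ^ 2 / (b + (n + 1)) - b / (b + (n + 1)) ^ 2) +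
          e * ((n : ℝ) + 1) ^ 0 := by
      intro n
      have hn : (0 : ℝ) ≤ n := n.cast_nonneg
      set c : ℝ := b + (n + 1) with hc
      have hcb : b + 1 ≤ c := by linarith
      have hc2 : 0 < c ^ 2 - 1 / 4 := by nlinarith
      have hc0 : 0 < c := by linarith
      have e1 : w n * (1 + a * ((n : ℝ) + 1 / 2)) - w (n + 1) * (1 - a * ((n : ℝ) + 3 / 2)) =
          2 * a * ((n : ℝ) + 1) ^ 2 / c - b / (c ^ 2 - 1 / 4) +
            a * b ^ 2 / (2 * c * (c ^ 2 - 1 / 4)) := by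
        obtain ⟨d, hd⟩ : ∃ d, d = b + n + 1 / 2 := ⟨_, rfl⟩
        have hd0 : 0 < d := by rw [hd]; positivity
        have h2 : b + ((n + 1 : ℕ) : ℝ) + 1 / 2 = d + 1 := by rw [hd]; push_cast; ring
        have h1 : c = (2 * d + 1) / 2 := by rw [hc, hd]; ring
        have h3 : c ^ 2 - 1 / 4 = d * (d + 1) := by rw [h1]; ring
        have h6 : (n : ℝ) = d - b - 1 / 2 := by rw [hd]; ring
        simp only [hw]
        rw [h2, ← hd, h3, h1]
        push_cast
        rw [h6]
        field_simp
        ring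
      have e2 : b / c ^ 2 ≤ b / (c ^ 2 - 1 / 4) := by
        gcongr
        linarith
      have e3 : a * b ^ 2 / (2 * c * (c ^ 2 - 1 / 4)) ≤ e := by
        rw [he, div_le_div_iff₀ (by positivity) (by positivity)]
        have h1 : (b + 1 / 2) * (b + 3 / 2) ≤ c ^ 2 - 1 / 4 := by nlinarith
        have h2 : (b + 1) * ((b + 1 / 2) * (b + 3 / 2)) ≤ c * (c ^ 2 - 1 / 4) := by gcongr
        have h3 : b ^ 2 * (2 * b + 1) ≤ 2 * ((b + 1) * ((b + 1 / 2) * (b + 3 / 2))) := by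
          nlinarith [sq_nonneg b]
        calc a * b ^ 2 * (2 * b + 1) = a * (b ^ 2 * (2 * b + 1)) := by ring
          _ ≤ a * (2 * (c * (c ^ 2 - 1 / 4))) :=
            mul_le_mul_of_nonneg_left (h3.trans (by linarith)) ha.le
          _ = _ := by ring
      rw [e1, pow_zero, mul_one]
      linarith
    have hfin := gsum_mono hκ (hpg.add ((polyGrowth_pow 0).const_mul e)) ha hcmp
    rw [gsum_add hpg ((polyGrowth_pow 0).const_mul e) ha, gsum_const_mul] at hfin
    have hw00 : w 0 = 1 / (2 * b + 1) := by
      simp only [hw, Nat.cast_zero]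
      field_simp
      ring
    rw [hw00] at key
    have h9 : e * gsum (fun n => ((n : ℝ) + 1) ^ 0) a ≤ 1 / (2 * b + 1) * (1 - a / 2) := by
      rw [he, div_mul_eq_mul_div, div_mul_eq_mul_div, one_mul]
      gcongr
      rw [gmoment] at hS
      linarith
    linarith

end GaussianSumBounds

end TruncatedGaussian


/-! ### The interpolating entire functions -/

namespace TruncatedGaussian

section Interpolation

/-- The entire function `sin (π z) / (π z)`. -/
noncomputable def csinc (z : ℂ) : ℂ :=
  dslope (fun w => Complex.sin (Real.pi * w)) 0 z / Real.pi

lemma csinc_zero : csinc 0 = 1 := by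
  have h : HasDerivAt (fun w : ℂ => Complex.sin (Real.pi * w))
      (Complex.cos (Real.pi * 0) * (Real.pi * 1)) 0 :=
    ((hasDerivAt_id (0 : ℂ)).const_mul (Real.pi : ℂ)).csin
  have hpi : (Real.pi : ℂ) ≠ 0 := by exact_mod_cast Real.pi_ne_zero
  rw [csinc, dslope_same, h.deriv]
  simp [hpi]

lemma csinc_of_ne_zero {z : ℂ} (hz : z ≠ 0) :
    csinc z = Complex.sin (Real.pi * z) / (Real.pi * z) := by
  rw [csinc, dslope_of_ne _ hz, slope_def_field]
  simp only [mul_zero, Complex.sin_zero, sub_zero]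
  rw [div_div, mul_comm z]

lemma differentiable_csinc : Differentiable ℂ csinc := by
  have h : Differentiable ℂ (fun w : ℂ => Complex.sin (Real.pi * w)) := by fun_prop
  have := (Complex.differentiableOn_dslope (c := (0 : ℂ)) univ_mem).2 h.differentiableOn
  exact (differentiableOn_univ.1 this).div_const _

lemma csinc_ofReal (x : ℝ) : csinc x = (Real.sinc (Real.pi * x) : ℝ) := by
  rcases eq_or_ne x 0 with rfl | hx
  · simp [csinc_zero]
  · rw [csinc_of_ne_zero (by exact_mod_cast hx), Real.sinc_of_ne_zero
      (mul_ne_zero Real.pi_ne_zero hx)]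
    push_cast
    rfl

lemma csinc_int {n : ℤ} (hn : n ≠ 0) : csinc n = 0 := by
  rw [csinc_of_ne_zero (by exact_mod_cast hn), mul_comm, Complex.sin_int_mul_pi, zero_div]

lemma isEntireOfExpType_csinc : IsEntireOfExpType Real.pi csinc := by
  refine ⟨differentiable_csinc, fun ε hε => ?_⟩
  obtain ⟨K, hK⟩ := (isCompact_closedBall (0 : ℂ) 1).exists_bound_of_continuousOn
    differentiable_csinc.continuous.continuousOn
  have hpi := Real.pi_gt_three
  refine ⟨max K 1, by positivity, fun z => ?_⟩
  have h1 : 1 ≤ Real.exp ((Real.pi + ε) * ‖z‖) := Real.one_le_exp (by positivity)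
  rcases le_total ‖z‖ 1 with h | h
  · calc _ ≤ K := hK z (by simpa using h)
      _ ≤ max K 1 * 1 := by simp
      _ ≤ _ := by gcongr
  · have hz : z ≠ 0 := by
      rintro rfl
      simp at h
      linarith
    rw [csinc_of_ne_zero hz, norm_div]
    have h2 : ‖Complex.sin (Real.pi * z)‖ ≤ Real.exp (Real.pi * ‖z‖) := by
      rw [Complex.sin, norm_div, norm_mul, Complex.norm_I, mul_one, Complex.norm_ofNat]
      have e : ‖(Real.pi : ℂ) * z * Complex.I‖ = Real.pi * ‖z‖ := by
        rw [norm_mul, norm_mul, Complex.norm_I, Complex.norm_real,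
          Real.norm_of_nonneg Real.pi_pos.le, mul_one]
      have e1 := Complex.norm_exp_le_exp_norm ((Real.pi : ℂ) * z * Complex.I)
      have e2 := Complex.norm_exp_le_exp_norm (-((Real.pi : ℂ) * z) * Complex.I)
      rw [neg_mul, norm_neg, e] at e2
      rw [e] at e1
      have e3 := norm_sub_le (Complex.exp (-((Real.pi : ℂ) * z) * Complex.I))
        (Complex.exp ((Real.pi : ℂ) * z * Complex.I))
      rw [neg_mul] at e3 ⊢
      linarith
    have h3 : 1 ≤ ‖(Real.pi : ℂ) * z‖ := by
      rw [norm_mul, Complex.norm_real, Real.norm_of_nonneg Real.pi_pos.le]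
      nlinarith
    calc _ ≤ ‖Complex.sin (Real.pi * z)‖ := div_le_self (norm_nonneg _) h3
      _ ≤ Real.exp ((Real.pi + ε) * ‖z‖) := by
        refine h2.trans ?_
        gcongr
        linarith
      _ ≤ _ := le_mul_of_one_le_left (Real.exp_pos _).le (le_max_right _ _)

lemma norm_csinc_le (z : ℂ) : ‖csinc z‖ ≤ Real.exp (Real.pi * |z.im|) := by
  have := isEntireOfExpType_csinc.norm_le_of_bounded_on_real Real.pi_pos.le (B := 1)
    (fun x => ?_) z
  · rwa [one_mul] at this
  · rw [csinc_ofReal, Complex.norm_real]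
    exact Real.abs_sinc_le_one _

lemma sinc_sq_le (x : ℝ) : Real.sinc (Real.pi * x) ^ 2 ≤ 2 / (1 + x ^ 2) := by
  have h1 : Real.sinc (Real.pi * x) ^ 2 ≤ 1 := by
    rw [sq_le_one_iff_abs_le_one]
    exact Real.abs_sinc_le_one _
  have h2 : x ^ 2 * Real.sinc (Real.pi * x) ^ 2 ≤ 1 := by
    rcases eq_or_ne x 0 with rfl | hx
    · simp
    · rw [Real.sinc_of_ne_zero (mul_ne_zero Real.pi_ne_zero hx)]
      have h3 := Real.sin_sq_le_one (Real.pi * x)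
      have hpi := Real.pi_gt_three
      have e : x ^ 2 * (Real.sin (Real.pi * x) / (Real.pi * x)) ^ 2 =
          Real.sin (Real.pi * x) ^ 2 / Real.pi ^ 2 := by field_simp
      rw [e, div_le_one (by positivity)]
      nlinarith
  rw [le_div_iff₀ (by positivity)]
  linarith

/-- Shifted versions decay with polynomial losses in the shift. -/
lemma sinc_sq_sub_le (x m : ℝ) :
    Real.sinc (Real.pi * (x - m)) ^ 2 ≤ 4 * (1 + m ^ 2) / (1 + x ^ 2) := by
  refine (sinc_sq_le _).trans ?_
  rw [div_le_div_iff₀ (by positivity) (by positivity)]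
  nlinarith [sq_nonneg (x - 2 * m), mul_nonneg (sq_nonneg m) (sq_nonneg (x - m))]

lemma IsEntireOfExpType.of_bound {σ : ℝ} {F : ℂ → ℂ} {K : ℝ} (hσ : 0 ≤ σ)
    (hF : Differentiable ℂ F)
    (h : ∀ z, ‖F z‖ ≤ K * Real.exp (σ * |z.im|)) : IsEntireOfExpType σ F := by
  refine ⟨hF, fun ε hε => ⟨max K 1, by positivity, fun z => (h z).trans ?_⟩⟩
  have h1 := Complex.abs_im_le_norm z
  have : σ * |z.im| ≤ (σ + ε) * ‖z‖ := by
    have : 0 ≤ ‖z‖ := norm_nonneg z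
    nlinarith [mul_le_mul_of_nonneg_left h1 hσ]
  calc K * Real.exp (σ * |z.im|) ≤ max K 1 * Real.exp (σ * |z.im|) := by
        gcongr
        exact le_max_left _ _
    _ ≤ _ := by gcongr

lemma norm_csinc_mul_csinc_le (z w : ℂ) (h : w.im = z.im) :
    ‖csinc z * csinc w‖ ≤ Real.exp (2 * Real.pi * |z.im|) := by
  rw [norm_mul]
  calc _ ≤ Real.exp (Real.pi * |z.im|) * Real.exp (Real.pi * |z.im|) :=
        mul_le_mul (norm_csinc_le z) (h ▸ norm_csinc_le w) (norm_nonneg _) (Real.exp_pos _).le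
    _ = _ := by rw [← Real.exp_add]; ring_nf

lemma isEntireOfExpType_csinc_sq :
    IsEntireOfExpType (2 * Real.pi) (fun z => csinc z ^ 2) := by
  refine IsEntireOfExpType.of_bound (K := 1) (by positivity) (differentiable_csinc.pow 2)
    fun z => ?_
  rw [sq, one_mul]
  exact norm_csinc_mul_csinc_le z z rfl

lemma integrable_of_decay {f : ℝ → ℂ} (hf : Continuous f) {K : ℝ}
    (h : ∀ x, ‖f x‖ ≤ K * (1 + x ^ 2)⁻¹) : Integrable f :=
  (integrable_inv_one_add_sq.const_mul K).mono' hf.aestronglyMeasurable (Eventually.of_forall h)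

lemma integrable_csinc_sq : Integrable (fun x : ℝ => csinc x ^ 2) := by
  refine integrable_of_decay (K := 2)
    ((differentiable_csinc.continuous.comp Complex.continuous_ofReal).pow 2) fun x => ?_
  rw [csinc_ofReal, ← Complex.ofReal_pow, Complex.norm_real, Real.norm_of_nonneg (sq_nonneg _)]
  exact (sinc_sq_le x).trans_eq (div_eq_mul_inv _ _)

/-- By Poisson summation the sum equals the integral for every `x`, hence its value at `x = 0`,
where only `n = 0` survives. -/
lemma hasSum_sinc_sq (x : ℝ) :
    HasSum (fun n : ℤ => Real.sinc (Real.pi * (x + n)) ^ 2) 1 := by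
  have h := fun y => isEntireOfExpType_csinc_sq.tsum_add_int integrable_csinc_sq y
  have hs := isEntireOfExpType_csinc_sq.summable_add_int integrable_csinc_sq x
  have h0 : ∑' n : ℤ, csinc ((0 + n : ℝ) : ℂ) ^ 2 = 1 := by
    rw [tsum_eq_single 0 fun n hn => ?_]
    · simp [csinc_zero]
    · have := csinc_int hn
      push_cast
      simp [this]
  have hx : HasSum (fun n : ℤ => csinc ((x + n : ℝ) : ℂ) ^ 2) 1 := by
    have := hs.hasSum
    rwa [h x, ← h 0, h0] at this
  simp only [csinc_ofReal, ← Complex.ofReal_pow] at hx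
  exact Complex.hasSum_ofReal.1 (by simpa using hx)

/-- The terms of the interpolation series at the positive integers, with `a = π λ`. -/
noncomputable def interpTerm (a : ℝ) (n : ℕ) (z : ℂ) : ℂ :=
  (Real.exp (-a * ((n : ℝ) + 1) ^ 2) : ℝ) * csinc (z - ((n : ℂ) + 1)) ^ 2 +
    ((-1 : ℝ) ^ n * (2 * a * ((n : ℝ) + 1) ^ 2 * Real.exp (-a * ((n : ℝ) + 1) ^ 2)) : ℝ) *
      (csinc z * csinc (z - ((n : ℂ) + 1)))

/-- The entire function interpolating the truncated Gaussian. -/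
noncomputable def interp (a : ℝ) (z : ℂ) : ℂ := ∑' n : ℕ, interpTerm a n z

variable {a : ℝ}

/-- Majorant coefficients of the interpolation series. -/
noncomputable def interpBound (a : ℝ) (n : ℕ) : ℝ :=
  (1 + 2 * a * ((n : ℝ) + 1) ^ 2) * Real.exp (-a * ((n : ℝ) + 1) ^ 2)

lemma summable_interpBound (ha : 0 < a) : Summable (interpBound a) := by
  refine ((summable_pow_mul_gaussian 0 ha).add
    ((summable_pow_mul_gaussian 2 ha).mul_left (2 * a))).congr fun n => ?_
  rw [interpBound]
  ring

lemma norm_interpTerm_le (ha : 0 < a) (n : ℕ) (z : ℂ) :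
    ‖interpTerm a n z‖ ≤ interpBound a n * Real.exp (2 * Real.pi * |z.im|) := by
  have him : (z - ((n : ℂ) + 1)).im = z.im := by simp
  have h1 := norm_csinc_mul_csinc_le (z - ((n : ℂ) + 1)) (z - ((n : ℂ) + 1)) rfl
  have h2 := norm_csinc_mul_csinc_le z (z - ((n : ℂ) + 1)) him
  rw [← sq, him] at h1
  refine (norm_add_le _ _).trans ?_
  rw [norm_mul, norm_mul, Complex.norm_real, Complex.norm_real, Real.norm_eq_abs,
    Real.norm_eq_abs, abs_mul, abs_pow, abs_neg, abs_one, one_pow, one_mul, Real.abs_exp,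
    abs_of_nonneg (by positivity : 0 ≤ 2 * a * ((n : ℝ) + 1) ^ 2 *
      Real.exp (-a * ((n : ℝ) + 1) ^ 2)), interpBound, add_mul, add_mul, one_mul]
  gcongr

lemma differentiable_interp (ha : 0 < a) : Differentiable ℂ (interp a) := by
  have hterm : ∀ n, Differentiable ℂ (interpTerm a n) := by
    intro n
    have := differentiable_csinc
    unfold interpTerm
    fun_prop
  intro z
  have ho : IsOpen {w : ℂ | |w.im| < |z.im| + 1} :=
    isOpen_lt (by fun_prop) continuous_const
  have := Complex.differentiableOn_tsum_of_summable_norm (F := interpTerm a)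
    ((summable_interpBound ha).mul_right (Real.exp (2 * Real.pi * (|z.im| + 1))))
    (fun n => (hterm n).differentiableOn) ho fun n w hw => (norm_interpTerm_le ha n w).trans ?_
  · exact this.differentiableAt (ho.mem_nhds (by simp))
  · have h0 : 0 ≤ interpBound a n := by rw [interpBound]; positivity
    have := le_of_lt (show |w.im| < |z.im| + 1 from hw)
    gcongr

lemma isEntireOfExpType_interp (ha : 0 < a) :
    IsEntireOfExpType (2 * Real.pi) (interp a) := by
  refine IsEntireOfExpType.of_bound (K := ∑' n, interpBound a n) (by positivity)
    (differentiable_interp ha) fun z => ?_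
  rw [← tsum_mul_right]
  exact tsum_of_norm_bounded ((summable_interpBound ha).mul_right _).hasSum
    fun n => norm_interpTerm_le ha n z

/-- Real form of the terms. -/
noncomputable def realTerm (a : ℝ) (n : ℕ) (x : ℝ) : ℝ :=
  Real.exp (-a * ((n : ℝ) + 1) ^ 2) * Real.sinc (Real.pi * (x - ((n : ℝ) + 1))) ^ 2 +
    (-1) ^ n * (2 * a * ((n : ℝ) + 1) ^ 2 * Real.exp (-a * ((n : ℝ) + 1) ^ 2)) *
      (Real.sinc (Real.pi * x) * Real.sinc (Real.pi * (x - ((n : ℝ) + 1))))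

lemma interpTerm_ofReal (a : ℝ) (n : ℕ) (x : ℝ) : interpTerm a n x = (realTerm a n x : ℝ) := by
  have : (x : ℂ) - ((n : ℂ) + 1) = ((x - ((n : ℝ) + 1) : ℝ) : ℂ) := by push_cast; ring
  rw [interpTerm, this, csinc_ofReal, csinc_ofReal, realTerm]
  push_cast
  ring

lemma interp_ofReal (a x : ℝ) : interp a x = (∑' n, realTerm a n x : ℝ) := by
  rw [interp, Complex.ofReal_tsum]
  exact tsum_congr fun n => interpTerm_ofReal a n x

lemma abs_realTerm_le (ha : 0 < a) (n : ℕ) (x : ℝ) :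
    |realTerm a n x| ≤ (6 * (1 + a * ((n : ℝ) + 1) ^ 2) * (1 + ((n : ℝ) + 1) ^ 2) *
      Real.exp (-a * ((n : ℝ) + 1) ^ 2)) * (1 + x ^ 2)⁻¹ := by
  set m : ℝ := (n : ℝ) + 1
  set q := Real.exp (-a * m ^ 2) with hq
  have hq0 : 0 < q := Real.exp_pos _
  set s := Real.sinc (Real.pi * x)
  set t := Real.sinc (Real.pi * (x - m))
  have h1 : s ^ 2 ≤ 2 * (1 + x ^ 2)⁻¹ := (sinc_sq_le x).trans_eq (div_eq_mul_inv _ _)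
  have h2 : t ^ 2 ≤ 4 * (1 + m ^ 2) * (1 + x ^ 2)⁻¹ :=
    (sinc_sq_sub_le x m).trans_eq (div_eq_mul_inv _ _)
  have h3 : |s * t| ≤ (s ^ 2 + t ^ 2) / 2 := by
    rw [abs_mul, ← sq_abs s, ← sq_abs t]
    nlinarith [sq_nonneg (|s| - |t|)]
  have hI : 0 < (1 + x ^ 2)⁻¹ := by positivity
  have h4 : |s * t| ≤ 3 * (1 + m ^ 2) * (1 + x ^ 2)⁻¹ := by
    nlinarith [mul_nonneg (sq_nonneg m) hI.le]
  have h5 : |realTerm a n x| ≤ q * t ^ 2 + 2 * a * m ^ 2 * q * |s * t| := by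
    refine (abs_add_le _ _).trans ?_
    change |q * t ^ 2| + |(-1) ^ n * (2 * a * m ^ 2 * q) * (s * t)| ≤ _
    rw [abs_of_nonneg (by positivity : 0 ≤ q * t ^ 2), abs_mul ((-1) ^ n * _),
      abs_mul ((-1 : ℝ) ^ n), abs_pow, abs_neg, abs_one, one_pow, one_mul,
      abs_of_nonneg (by positivity : 0 ≤ 2 * a * m ^ 2 * q)]
  have h6 : 0 ≤ 2 * a * m ^ 2 * q := by positivity
  calc _ ≤ _ := h5
    _ ≤ q * (4 * (1 + m ^ 2) * (1 + x ^ 2)⁻¹) +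
        2 * a * m ^ 2 * q * (3 * (1 + m ^ 2) * (1 + x ^ 2)⁻¹) := by gcongr
    _ ≤ _ := by
      have : 0 ≤ q * (1 + m ^ 2) * (1 + x ^ 2)⁻¹ := by positivity
      linarith

lemma exists_interp_decay (ha : 0 < a) : ∃ K, ∀ x : ℝ, ‖interp a x‖ ≤ K * (1 + x ^ 2)⁻¹ := by
  have hs : Summable fun n : ℕ => 6 * (1 + a * ((n : ℝ) + 1) ^ 2) * (1 + ((n : ℝ) + 1) ^ 2) *
      Real.exp (-a * ((n : ℝ) + 1) ^ 2) := by
    have h0 := (summable_pow_mul_gaussian 0 ha).mul_left 6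
    have h2 := (summable_pow_mul_gaussian 2 ha).mul_left (6 * (a + 1))
    have h4 := (summable_pow_mul_gaussian 4 ha).mul_left (6 * a)
    refine ((h0.add h2).add h4).congr fun n => ?_
    ring
  refine ⟨∑' n : ℕ, 6 * (1 + a * ((n : ℝ) + 1) ^ 2) * (1 + ((n : ℝ) + 1) ^ 2) *
      Real.exp (-a * ((n : ℝ) + 1) ^ 2), fun x => ?_⟩
  rw [interp_ofReal, Complex.norm_real, ← tsum_mul_right]
  exact tsum_of_norm_bounded (hs.mul_right _).hasSum fun n => abs_realTerm_le ha n x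

lemma integrable_interp (ha : 0 < a) : Integrable (fun x : ℝ => interp a x) := by
  obtain ⟨K, hK⟩ := exists_interp_decay ha
  exact integrable_of_decay
    ((differentiable_interp ha).continuous.comp Complex.continuous_ofReal) hK

lemma interp_natCast_add_one (a : ℝ) (k : ℕ) :
    interp a ((k : ℂ) + 1) = (Real.exp (-a * ((k : ℝ) + 1) ^ 2) : ℝ) := by
  have h0 : csinc ((k : ℂ) + 1) = 0 := by
    have := csinc_int (n := (k : ℤ) + 1) (by omega)
    exact_mod_cast this
  rw [interp, tsum_eq_single k fun n hn => ?_]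
  · simp [interpTerm, csinc_zero, h0]
  · have h1 : csinc ((k : ℂ) + 1 - ((n : ℂ) + 1)) = 0 := by
      have := csinc_int (n := (k : ℤ) - n) (by omega)
      push_cast at this
      rwa [add_sub_add_right_eq_sub]
    rw [interpTerm, h1]
    simp

lemma interp_int_of_nonpos (a : ℝ) {k : ℤ} (hk : k ≤ 0) : interp a (k : ℂ) = 0 := by
  rw [interp]
  refine (tsum_congr fun n => ?_).trans tsum_zero
  have h1 : csinc ((k : ℂ) - ((n : ℂ) + 1)) = 0 := by
    have := csinc_int (n := k - (n + 1)) (by omega)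
    push_cast at this
    exact this
  simp [interpTerm, h1]

lemma gaussian_natCast_add_one (lam : ℝ) (n : ℕ) :
    gaussian lam ((n : ℂ) + 1) = (Real.exp (-(Real.pi * lam) * ((n : ℝ) + 1) ^ 2) : ℝ) := by
  rw [gaussian]
  push_cast
  ring_nf

lemma deriv_gaussian (lam : ℝ) (z : ℂ) :
    deriv (gaussian lam) z = -(2 * (Real.pi * lam) * z) * gaussian lam z := by
  have h : HasDerivAt (gaussian lam)
      (Complex.exp (-(Real.pi : ℂ) * (lam : ℂ) * z ^ 2) *
        (-(Real.pi : ℂ) * (lam : ℂ) * (2 * z))) z := by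
    have := ((hasDerivAt_pow 2 z).const_mul (-(Real.pi : ℂ) * (lam : ℂ))).cexp
    simp only [Nat.cast_ofNat, Nat.add_one_sub_one, pow_one] at this
    exact this
  rw [h.deriv, gaussian]
  ring

lemma sin_pi_mul_sub_nat (z : ℂ) (n : ℕ) :
    Complex.sin (Real.pi * (z - ((n : ℂ) + 1))) = -(-1) ^ n * Complex.sin (Real.pi * z) := by
  have : (Real.pi : ℂ) * (z - ((n : ℂ) + 1)) = Real.pi * z - ((n + 1 : ℕ) : ℂ) * Real.pi := by
    push_cast; ring
  rw [this, Complex.sin_sub, Complex.sin_nat_mul_pi]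
  have hc : Complex.cos (((n + 1 : ℕ) : ℂ) * Real.pi) = (-1) ^ (n + 1) := by
    exact_mod_cast congrArg (fun x : ℝ => (x : ℂ)) (Real.cos_nat_mul_pi (n + 1))
  rw [hc, pow_succ]
  ring

/-- Put `m = n + 1`. From `1/(z - m) - 1/z = m / (z (z - m))` and `G'(m) = -2 a m G(m)` with `a = π
λ`, each term has only poles cancelled by `sin²`. Rewriting `sin (π z)` through `sin (π (z - m))`
produces the sincs and the sign `(-1) ^ n`. -/
lemma minorantSeries_eq_interp (lam : ℝ) {z : ℂ} (hz : ∀ n : ℕ, z ≠ n) :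
    minorantSeries lam z = interp (Real.pi * lam) z := by
  rw [minorantSeries, interp, ← tsum_mul_left]
  refine tsum_congr fun n => ?_
  have hz0 : z ≠ 0 := by simpa using hz 0
  have hzn : z - ((n : ℂ) + 1) ≠ 0 := by
    have := hz (n + 1)
    push_cast at this
    exact sub_ne_zero.2 this
  have hpi : (Real.pi : ℂ) ≠ 0 := by exact_mod_cast Real.pi_ne_zero
  have hsq : ((-1 : ℂ) ^ n) ^ 2 = 1 := by rw [← pow_mul, mul_comm, pow_mul]; simp
  rw [interpTerm, csinc_of_ne_zero hz0, csinc_of_ne_zero hzn, sin_pi_mul_sub_nat, deriv_gaussian,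
    gaussian_natCast_add_one]
  push_cast
  set E := Complex.exp (-(Real.pi * lam) * ((n : ℂ) + 1) ^ 2)
  set S := Complex.sin (Real.pi * z)
  set w := z - ((n : ℂ) + 1) with hw
  have hzw : z = w + ((n : ℂ) + 1) := by rw [hw]; ring
  set u := (-1 : ℂ) ^ n
  have e1 : (u * (2 * (Real.pi * lam) * ((n : ℂ) + 1) ^ 2 * E)) *
      (S / (Real.pi * z) * (-u * S / (Real.pi * w))) =
      - (2 * (Real.pi * lam) * ((n : ℂ) + 1) ^ 2 * E) * (S ^ 2 / (Real.pi ^ 2 * z * w)) := by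
    calc _ = -(u ^ 2) * (2 * (Real.pi * lam) * ((n : ℂ) + 1) ^ 2 * E) *
          (S ^ 2 / (Real.pi ^ 2 * z * w)) := by
          field_simp
      _ = _ := by rw [hsq]; ring
  have e2 : (-u * S / (Real.pi * w)) ^ 2 = S ^ 2 / (Real.pi ^ 2 * w ^ 2) := by
    rw [div_pow, mul_pow, mul_pow, neg_sq, hsq, one_mul]
  rw [e1, e2]
  field_simp
  rw [hzw]
  ring

/-- The naturals are closed and discrete in `ℂ`, so near any point the series agrees with `interp`
off that point; this evaluates the limits defining `Lplus` and `Mplus`. -/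
lemma eventually_ne_natCast (z : ℂ) : ∀ᶠ w : ℂ in 𝓝[≠] z, ∀ n : ℕ, w ≠ (n : ℂ) := by
  have hemb : Topology.IsClosedEmbedding ((↑) : ℕ → ℂ) :=
    Metric.isClosedEmbedding_of_pairwise_le_dist one_pos fun m n hmn => by
      change 1 ≤ dist (m : ℂ) (n : ℂ)
      rw [dist_eq_norm]
      have : (m : ℂ) - n = ((m - n : ℤ) : ℂ) := by push_cast; ring
      rw [this, Complex.norm_intCast]
      have h1 : (1 : ℤ) ≤ |(m : ℤ) - n| :=
        Int.one_le_abs (sub_ne_zero.2 (by exact_mod_cast hmn))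
      exact_mod_cast h1
  have hcl := hemb.isClosedMap _ (isClosed_discrete {n : ℕ | (n : ℂ) ≠ z})
  have hmem : z ∈ (((↑) : ℕ → ℂ) '' {n : ℕ | (n : ℂ) ≠ z})ᶜ := by
    rintro ⟨n, hn, h⟩
    exact hn h
  filter_upwards [nhdsWithin_le_nhds (hcl.isOpen_compl.mem_nhds hmem),
    self_mem_nhdsWithin] with w hw hwz n hn
  exact hw ⟨n, fun h => hwz (hn.trans h), hn.symm⟩

lemma Lplus_eq_interp {lam : ℝ} (hlam : 0 < lam) : Lplus lam = interp (Real.pi * lam) := by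
  funext z
  have ha : 0 < Real.pi * lam := by have := Real.pi_pos; positivity
  refine Tendsto.limUnder_eq ?_
  refine Tendsto.congr' ?_ ((differentiable_interp ha).continuous.tendsto z |>.mono_left
    nhdsWithin_le_nhds)
  filter_upwards [eventually_ne_natCast z] with w hw
  rw [minorantSeries_eq_interp lam hw]

lemma majorantSeries_eq (lam : ℝ) {z : ℂ} (hz : ∀ n : ℕ, z ≠ n) :
    majorantSeries lam z = interp (Real.pi * lam) z + csinc z ^ 2 := by
  have hz0 : z ≠ 0 := by simpa using hz 0
  rw [majorantSeries, minorantSeries_eq_interp lam hz, csinc_of_ne_zero hz0, div_pow, mul_pow]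

lemma Mplus_eq_interp {lam : ℝ} (hlam : 0 < lam) :
    Mplus lam = fun z => interp (Real.pi * lam) z + csinc z ^ 2 := by
  funext z
  have ha : 0 < Real.pi * lam := by have := Real.pi_pos; positivity
  refine Tendsto.limUnder_eq ?_
  refine Tendsto.congr' ?_ ((((differentiable_interp ha).continuous.add
    (differentiable_csinc.continuous.pow 2)).tendsto z).mono_left nhdsWithin_le_nhds)
  filter_upwards [eventually_ne_natCast z] with w hw
  rw [majorantSeries_eq lam hw]
  rfl

end Interpolation

end TruncatedGaussian


/-! ### The inequalities `L⁺ ≤ G⁺ ≤ M⁺` off the integers -/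

namespace TruncatedGaussian

section Inequalities

variable {a x : ℝ}

lemma exists_dist_natCast_pos (hx : ∀ n : ℤ, x ≠ n) :
    ∃ δ > 0, ∀ n : ℕ, δ ≤ |x - ((n : ℝ) + 1)| := by
  refine ⟨|x - round x|, abs_pos.2 (sub_ne_zero.2 (hx _)), fun n => ?_⟩
  have := round_le x ((n : ℤ) + 1)
  push_cast at this
  exact this

lemma ne_intCast_neg (hx : ∀ n : ℤ, x ≠ n) (n : ℤ) : -x ≠ n := fun h =>
  hx (-n) (by push_cast; linarith)

lemma sub_natCast_add_one_ne_zero (hx : ∀ n : ℤ, x ≠ n) (n : ℕ) : x - ((n : ℝ) + 1) ≠ 0 := by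
  have := hx (n + 1)
  push_cast at this
  exact sub_ne_zero.2 this

lemma polyGrowth_inv_sub (hx : ∀ n : ℤ, x ≠ n) : PolyGrowth fun n => 1 / (x - ((n : ℝ) + 1)) := by
  obtain ⟨δ, hδ, h⟩ := exists_dist_natCast_pos hx
  refine PolyGrowth.of_bounded (K := 1 / δ) fun n => ?_
  rw [abs_div, abs_one]
  exact one_div_le_one_div_of_le hδ (h n)

lemma polyGrowth_inv_sub_sq (hx : ∀ n : ℤ, x ≠ n) :
    PolyGrowth fun n => 1 / (x - ((n : ℝ) + 1)) ^ 2 := by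
  have h := (polyGrowth_inv_sub hx).mul (polyGrowth_inv_sub hx)
  refine (funext fun n => ?_ : (fun n : ℕ => 1 / (x - ((n : ℝ) + 1)) ^ 2) = _) ▸ h
  rw [div_mul_div_comm, one_mul, sq]

lemma polyGrowth_sq_div (hx : ∀ n : ℤ, x ≠ n) :
    PolyGrowth fun n => ((n : ℝ) + 1) ^ 2 / (x * (x - ((n : ℝ) + 1))) := by
  have h := ((polyGrowth_pow 2).mul (polyGrowth_inv_sub hx)).const_mul (1 / x)
  refine (funext fun n => ?_ :
    (fun n : ℕ => ((n : ℝ) + 1) ^ 2 / (x * (x - ((n : ℝ) + 1)))) = _) ▸ h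
  have := sub_natCast_add_one_ne_zero hx n
  have h0 : x ≠ 0 := by simpa using hx 0
  field_simp

/-- The real interpolation series without the factor `sin² (π x) / π²`. -/
noncomputable def cSum (x a : ℝ) : ℝ :=
  gsum (fun n => 1 / (x - ((n : ℝ) + 1)) ^ 2) a -
    2 * a * gsum (fun n => ((n : ℝ) + 1) ^ 2 / (x * (x - ((n : ℝ) + 1)))) a

lemma sinc_sub_natCast (hx : ∀ n : ℤ, x ≠ n) (n : ℕ) :
    Real.sinc (Real.pi * (x - ((n : ℝ) + 1))) =
      -(-1) ^ n * Real.sin (Real.pi * x) / (Real.pi * (x - ((n : ℝ) + 1))) := by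
  rw [Real.sinc_of_ne_zero (mul_ne_zero Real.pi_ne_zero (sub_natCast_add_one_ne_zero hx n))]
  have : Real.pi * (x - ((n : ℝ) + 1)) = Real.pi * x - ((n + 1 : ℕ) : ℝ) * Real.pi := by
    push_cast; ring
  congr 1
  rw [this, Real.sin_sub_nat_mul_pi, pow_succ]
  ring

lemma realTerm_eq (hx : ∀ n : ℤ, x ≠ n) (a : ℝ) (n : ℕ) :
    realTerm a n x = Real.sin (Real.pi * x) ^ 2 / Real.pi ^ 2 *
      ((1 / (x - ((n : ℝ) + 1)) ^ 2) * Real.exp (-a * ((n : ℝ) + 1) ^ 2) -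
        2 * a * (((n : ℝ) + 1) ^ 2 / (x * (x - ((n : ℝ) + 1))) *
          Real.exp (-a * ((n : ℝ) + 1) ^ 2))) := by
  have h0 : x ≠ 0 := by simpa using hx 0
  have h1 := sub_natCast_add_one_ne_zero hx n
  have hpi := Real.pi_ne_zero
  have hsq : ((-1 : ℝ) ^ n) ^ 2 = 1 := by rw [← pow_mul, mul_comm, pow_mul]; simp
  rw [realTerm, sinc_sub_natCast hx, Real.sinc_of_ne_zero (mul_ne_zero hpi h0)]
  set E := Real.exp (-a * ((n : ℝ) + 1) ^ 2)
  set S := Real.sin (Real.pi * x)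
  set m := (n : ℝ) + 1
  set w := x - m
  set u := (-1 : ℝ) ^ n
  have e1 : u * (2 * a * m ^ 2 * E) * (S / (Real.pi * x) * (-u * S / (Real.pi * w))) =
      -(2 * a * m ^ 2 * E) * (S ^ 2 / (Real.pi ^ 2 * x * w)) := by
    calc _ = -(u ^ 2) * (2 * a * m ^ 2 * E) * (S ^ 2 / (Real.pi ^ 2 * x * w)) := by
          field_simp
      _ = _ := by rw [hsq]; ring
  have e2 : (-u * S / (Real.pi * w)) ^ 2 = S ^ 2 / (Real.pi ^ 2 * w ^ 2) := by
    rw [div_pow, mul_pow, mul_pow, neg_sq, hsq, one_mul]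
  rw [e1, e2]
  field_simp
  ring

lemma interp_eq_cSum (ha : 0 < a) (hx : ∀ n : ℤ, x ≠ n) :
    (interp a x).re = Real.sin (Real.pi * x) ^ 2 / Real.pi ^ 2 * cSum x a := by
  rw [interp_ofReal, Complex.ofReal_re, tsum_congr (realTerm_eq hx a), tsum_mul_left,
    ((polyGrowth_inv_sub_sq hx).summable ha).tsum_sub
      (((polyGrowth_sq_div hx).summable ha).mul_left _), tsum_mul_left]
  rfl

lemma gsum_sq_div (ha : 0 < a) (hx : ∀ n : ℤ, x ≠ n) :
    gsum (fun n => ((n : ℝ) + 1) ^ 2 / (x * (x - ((n : ℝ) + 1)))) a =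
      x * gsum (fun n => 1 / (x - ((n : ℝ) + 1))) a - gmoment 0 a - 1 / x * gmoment 1 a := by
  have h0 : x ≠ 0 := by simpa using hx 0
  have ht := (polyGrowth_inv_sub hx).const_mul x
  rw [gmoment, gmoment, ← gsum_const_mul, ← gsum_const_mul, ← gsum_sub ht (polyGrowth_pow 0) ha,
    ← gsum_sub (ht.sub (polyGrowth_pow 0)) ((polyGrowth_pow 1).const_mul _) ha]
  congr 1
  funext n
  have := sub_natCast_add_one_ne_zero hx n
  field_simp
  ring

lemma gsum_sq_mul_inv_sub_sq (ha : 0 < a) (hx : ∀ n : ℤ, x ≠ n) :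
    gsum (fun n => ((n : ℝ) + 1) ^ 2 * (1 / (x - ((n : ℝ) + 1)) ^ 2)) a =
      x ^ 2 * gsum (fun n => 1 / (x - ((n : ℝ) + 1)) ^ 2) a -
        2 * x * gsum (fun n => 1 / (x - ((n : ℝ) + 1))) a + gmoment 0 a := by
  have ht := (polyGrowth_inv_sub hx).const_mul (2 * x)
  have hu := (polyGrowth_inv_sub_sq hx).const_mul (x ^ 2)
  rw [gmoment, ← gsum_const_mul, ← gsum_const_mul, ← gsum_sub hu ht ha,
    ← gsum_add (hu.sub ht) (polyGrowth_pow 0) ha]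
  congr 1
  funext n
  have := sub_natCast_add_one_ne_zero hx n
  field_simp
  ring

lemma gsum_sq_mul_sq_div (ha : 0 < a) (hx : ∀ n : ℤ, x ≠ n) :
    gsum (fun n => ((n : ℝ) + 1) ^ 2 * (((n : ℝ) + 1) ^ 2 / (x * (x - ((n : ℝ) + 1))))) a =
      x ^ 2 * gsum (fun n => ((n : ℝ) + 1) ^ 2 / (x * (x - ((n : ℝ) + 1)))) a -
        gmoment 2 a - 1 / x * gmoment 3 a := by
  have h0 : x ≠ 0 := by simpa using hx 0
  have hv := (polyGrowth_sq_div hx).const_mul (x ^ 2)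
  rw [gmoment, gmoment, ← gsum_const_mul, ← gsum_const_mul, ← gsum_sub hv (polyGrowth_pow 2) ha,
    ← gsum_sub (hv.sub (polyGrowth_pow 2)) ((polyGrowth_pow 3).const_mul _) ha]
  congr 1
  funext n
  have := sub_natCast_add_one_ne_zero hx n
  field_simp
  ring

/-- Differentiating brings down `m²`. Division by `x - m` leaves `x²` times the original sums,
cancelled by the derivative of `exp (a x²)`, plus moments free of poles, which assemble to `p` and
`r`. -/
lemma hasDerivAt_exp_mul_cSum (ha : 0 < a) (hx : ∀ n : ℤ, x ≠ n) :
    HasDerivAt (fun b => Real.exp (b * x ^ 2) * cSum x b)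
      (-(Real.exp (a * x ^ 2) * (pSum a + 2 / x * rSum a))) a := by
  have h0 : x ≠ 0 := by simpa using hx 0
  have h1 : HasDerivAt (fun b => Real.exp (b * x ^ 2)) (Real.exp (a * x ^ 2) * (1 * x ^ 2)) a :=
    ((hasDerivAt_id a).mul_const (x ^ 2)).exp
  have h2 := (hasDerivAt_gsum (polyGrowth_inv_sub_sq hx) ha).sub
    (((hasDerivAt_id a).const_mul 2).mul (hasDerivAt_gsum (polyGrowth_sq_div hx) ha))
  refine (h1.mul h2).congr_deriv ?_
  simp only [id, Pi.sub_apply, Pi.mul_apply]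
  rw [gsum_sq_mul_inv_sub_sq ha hx, gsum_sq_mul_sq_div ha hx, gsum_sq_div ha hx, pSum, rSum]
  field_simp
  ring

lemma cSum_eq (ha : 0 < a) (hx : ∀ n : ℤ, x ≠ n) :
    cSum x a = gsum (fun n => 1 / (x - ((n : ℝ) + 1)) ^ 2) a + 2 * (a * gmoment 0 a) +
      2 / x * (a * gmoment 1 a) - 2 * x * (a * gsum (fun n => 1 / (x - ((n : ℝ) + 1))) a) := by
  rw [cSum, gsum_sq_div ha hx]
  ring

/-- By the theta functional equation `gmoment 0 a` is `O(1/√a)` as `a → 0⁺`. -/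
lemma tendsto_mul_gmoment_zero : Tendsto (fun a => a * gmoment 0 a) (𝓝[>] 0) (𝓝 0) := by
  have hb : ∀ᶠ a : ℝ in 𝓝[>] 0, a * gmoment 0 a ≤ √a * (√Real.pi * (1 + 2 * gmoment 0 1)) := by
    filter_upwards [Ioo_mem_nhdsGT (show (0 : ℝ) < 1 by norm_num)] with a ha
    have ha0 := ha.1
    have h1 := sqrt_mul_theta ha.1
    have hpi := Real.pi_gt_three
    have hle : 1 ≤ Real.pi ^ 2 / a := by
      rw [le_div_iff₀ ha.1]
      nlinarith [ha.2]
    have h2 : gmoment 0 (Real.pi ^ 2 / a) ≤ gmoment 0 1 := by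
      refine Summable.tsum_le_tsum (fun n => ?_) ((polyGrowth_pow 0).summable (by positivity))
        ((polyGrowth_pow 0).summable one_pos)
      gcongr
    have h3 := gmoment_nonneg 0 a
    have h4 : √a * √a = a := Real.mul_self_sqrt ha.1.le
    calc a * gmoment 0 a = √a * (√a * gmoment 0 a) := by rw [← mul_assoc, h4]
      _ ≤ √a * (√a * (1 + 2 * gmoment 0 a)) := by gcongr; linarith
      _ ≤ √a * (√Real.pi * (1 + 2 * gmoment 0 1)) := by rw [h1]; gcongr
  refine tendsto_of_tendsto_of_tendsto_of_le_of_le' tendsto_const_nhds ?_ ?_ hb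
  · have : Tendsto (fun a : ℝ => √a * (√Real.pi * (1 + 2 * gmoment 0 1))) (𝓝 0)
        (𝓝 (√0 * (√Real.pi * (1 + 2 * gmoment 0 1)))) :=
      (Real.continuous_sqrt.tendsto 0).mul_const _
    simpa using this.mono_left nhdsWithin_le_nhds
  · filter_upwards [self_mem_nhdsWithin] with a ha
    exact mul_nonneg (le_of_lt ha) (gmoment_nonneg 0 a)

lemma tendsto_mul_gsum_inv_sub (hx : ∀ n : ℤ, x ≠ n) :
    Tendsto (fun a => a * gsum (fun n => 1 / (x - ((n : ℝ) + 1))) a) (𝓝[>] 0) (𝓝 0) := by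
  obtain ⟨δ, hδ, h⟩ := exists_dist_natCast_pos hx
  have hb : Tendsto (fun a => 1 / δ * (a * gmoment 0 a)) (𝓝[>] 0) (𝓝 0) := by
    simpa using tendsto_mul_gmoment_zero.const_mul (1 / δ)
  refine squeeze_zero_norm' ?_ hb
  filter_upwards [self_mem_nhdsWithin] with a ha
  have ha0 : 0 < a := ha
  rw [Real.norm_eq_abs, abs_mul, abs_of_pos ha0, mul_left_comm]
  gcongr
  rw [gmoment, ← gsum_const_mul, ← Real.norm_eq_abs]
  refine tsum_of_norm_bounded ((((polyGrowth_pow 0).const_mul (1 / δ)).summable ha0).hasSum)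
    fun n => ?_
  rw [norm_mul, Real.norm_eq_abs, Real.norm_eq_abs, Real.abs_exp, abs_div, abs_one, pow_zero,
    mul_one]
  gcongr
  exact h n

lemma sin_pi_mul_ne_zero (hx : ∀ n : ℤ, x ≠ n) : Real.sin (Real.pi * x) ≠ 0 := by
  intro h
  obtain ⟨n, hn⟩ := Real.sin_eq_zero_iff.1 h
  rw [mul_comm] at hn
  exact hx n (mul_left_cancel₀ Real.pi_ne_zero hn).symm

/-- The identity `∑ sinc² = 1` divided by `sin² (π x) / π²`, which is unchanged by integer shifts of
`x`. -/
lemma hasSum_inv_add_sq (hx : ∀ n : ℤ, x ≠ n) :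
    HasSum (fun n : ℤ => 1 / (x + n) ^ 2) (Real.pi ^ 2 / Real.sin (Real.pi * x) ^ 2) := by
  have hs := sin_pi_mul_ne_zero hx
  have h := (hasSum_sinc_sq x).mul_left (Real.pi ^ 2 / Real.sin (Real.pi * x) ^ 2)
  rw [mul_one] at h
  refine (funext fun n => ?_ : (fun n : ℤ => 1 / (x + n) ^ 2) = _) ▸ h
  have hn : x + n ≠ 0 := fun h => hx (-n) (by push_cast; linarith)
  have hpi := Real.pi_ne_zero
  have e : Real.sin (Real.pi * (x + n)) ^ 2 = Real.sin (Real.pi * x) ^ 2 := by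
    rw [mul_add, mul_comm Real.pi (n : ℝ), Real.sin_add_int_mul_pi, mul_pow]
    rcases Int.even_or_odd n with h | h
    · simp [h.neg_one_zpow]
    · simp [h.neg_one_zpow]
  rw [Real.sinc_of_ne_zero (mul_ne_zero hpi hn), div_pow, e]
  generalize Real.sin (Real.pi * x) = S at hs
  field_simp

lemma summable_inv_sub_sq (hx : ∀ n : ℤ, x ≠ n) :
    Summable fun n : ℕ => 1 / (x - ((n : ℝ) + 1)) ^ 2 := by
  have h := (hasSum_inv_add_sq hx).summable.comp_injective
    (i := fun n : ℕ => -((n : ℤ) + 1)) (fun m n h => by simpa using h)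
  refine h.congr fun n => ?_
  simp only [Function.comp]
  push_cast
  ring_nf

lemma pi_sq_div_sin_sq (hx : ∀ n : ℤ, x ≠ n) :
    Real.pi ^ 2 / Real.sin (Real.pi * x) ^ 2 = 1 / x ^ 2 +
      ∑' n : ℕ, 1 / (x - ((n : ℝ) + 1)) ^ 2 + ∑' n : ℕ, 1 / (-x - ((n : ℝ) + 1)) ^ 2 := by
  have h := (hasSum_inv_add_sq hx)
  have h1 := summable_inv_sub_sq hx
  have h2 : HasSum (fun n : ℕ => 1 / (-x - ((n : ℝ) + 1)) ^ 2) _ :=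
    (summable_inv_sub_sq (ne_intCast_neg hx)).hasSum
  have h3 : HasSum (fun n : ℕ => 1 / (x + ((n : ℤ) : ℝ)) ^ 2)
      (1 / x ^ 2 + ∑' n : ℕ, 1 / (-x - ((n : ℝ) + 1)) ^ 2) := by
    rw [← hasSum_nat_add_iff' 1]
    simp only [Finset.range_one, Finset.sum_singleton, Nat.cast_zero, Int.cast_zero, add_zero,
      add_sub_cancel_left]
    refine (funext fun n => ?_ : (fun n : ℕ => 1 / (-x - ((n : ℝ) + 1)) ^ 2) = _) ▸ h2
    push_cast
    rw [← neg_sq]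
    ring_nf
  have h4 : HasSum (fun n : ℕ => 1 / (x + ((-((n : ℤ) + 1) : ℤ) : ℝ)) ^ 2)
      (∑' n : ℕ, 1 / (x - ((n : ℝ) + 1)) ^ 2) := by
    refine (funext fun n => ?_ : (fun n : ℕ => 1 / (x - ((n : ℝ) + 1)) ^ 2) = _) ▸ h1.hasSum
    push_cast
    ring_nf
  rw [h.unique (HasSum.of_nat_of_neg_add_one (f := fun n : ℤ => 1 / (x + (n : ℝ)) ^ 2) h3 h4)]
  ring

lemma tendsto_gsum_inv_sub_sq (hx : ∀ n : ℤ, x ≠ n) :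
    Tendsto (gsum fun n => 1 / (x - ((n : ℝ) + 1)) ^ 2) (𝓝[>] 0)
      (𝓝 (∑' n : ℕ, 1 / (x - ((n : ℝ) + 1)) ^ 2)) := by
  refine tendsto_tsum_of_dominated_convergence (summable_inv_sub_sq hx) (fun n => ?_) ?_
  · have : Tendsto (fun a : ℝ => 1 / (x - ((n : ℝ) + 1)) ^ 2 * Real.exp (-a * ((n : ℝ) + 1) ^ 2))
        (𝓝 0) (𝓝 (1 / (x - ((n : ℝ) + 1)) ^ 2 * Real.exp (-0 * ((n : ℝ) + 1) ^ 2))) :=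
      Continuous.tendsto (by fun_prop) 0
    simpa using this.mono_left nhdsWithin_le_nhds
  · filter_upwards [self_mem_nhdsWithin] with a ha n
    have ha0 : 0 < a := ha
    rw [Real.norm_of_nonneg (by positivity)]
    refine mul_le_of_le_one_right (by positivity) (Real.exp_le_one_iff.2 ?_)
    have : 0 ≤ a * ((n : ℝ) + 1) ^ 2 := by positivity
    linarith

lemma tendsto_exp_mul_sq (x : ℝ) : Tendsto (fun a => Real.exp (a * x ^ 2)) (𝓝[>] 0) (𝓝 1) := by
  have : Tendsto (fun a => Real.exp (a * x ^ 2)) (𝓝 0) (𝓝 (Real.exp (0 * x ^ 2))) :=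
    Continuous.tendsto (by fun_prop) 0
  simpa using this.mono_left nhdsWithin_le_nhds

/-- Telescoping bound for the trigamma series. -/
lemma one_div_le_inv_sq_add_tsum (hx : ∀ n : ℤ, x ≠ n) (h0 : 0 < x) :
    1 / x ≤ 1 / x ^ 2 + ∑' n : ℕ, 1 / (-x - ((n : ℝ) + 1)) ^ 2 := by
  have hs := (summable_inv_sub_sq (ne_intCast_neg hx)).hasSum.tendsto_sum_nat
  have hl : Tendsto (fun N : ℕ => 1 / x - 1 / (x + (N + 1))) atTop (𝓝 (1 / x - 0)) := by
    refine tendsto_const_nhds.sub ?_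
    simp only [one_div]
    exact tendsto_inv_atTop_zero.comp (tendsto_atTop_add_const_left _ _
      (tendsto_atTop_add_const_right _ _ tendsto_natCast_atTop_atTop))
  rw [sub_zero] at hl
  refine le_of_tendsto_of_tendsto' hl (tendsto_const_nhds.add hs) fun N => ?_
  induction N with
  | zero =>
    have : 1 / x - 1 / (x + ((0 : ℕ) + 1)) = 1 / (x * (x + 1)) := by
      push_cast
      field_simp
      ring
    rw [this, Finset.sum_range_zero, add_zero]
    exact one_div_le_one_div_of_le (by positivity) (by nlinarith)
  | succ N ih =>
    rw [Finset.sum_range_succ]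
    have e : 1 / (x + ((N : ℝ) + 1)) - 1 / (x + (((N + 1 : ℕ) : ℝ) + 1)) ≤
        1 / (-x - ((N : ℝ) + 1)) ^ 2 := by
      have : (-x - ((N : ℝ) + 1)) ^ 2 = (x + ((N : ℝ) + 1)) ^ 2 := by ring
      rw [this]
      push_cast
      have h2 : 0 < x + ((N : ℝ) + 1) := by positivity
      rw [div_sub_div _ _ (by positivity) (by positivity), div_le_div_iff₀ (by positivity)
        (by positivity)]
      nlinarith
    linarith

lemma cSum_nonpos (ha : 0 < a) (hx : ∀ n : ℤ, x ≠ n) (h0 : x < 0) : cSum x a ≤ 0 := by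
  have hb : 0 < -x := neg_pos.2 h0
  have h := gsum_left_nonneg ha hb
  have e : cSum x a = 1 / x * gsum (fun n =>
      2 * a * ((n : ℝ) + 1) ^ 2 / (-x + (n + 1)) - -x / (-x + (n + 1)) ^ 2) a := by
    rw [cSum, ← gsum_const_mul, ← gsum_const_mul, ← gsum_sub (polyGrowth_inv_sub_sq hx)
      ((polyGrowth_sq_div hx).const_mul _) ha]
    congr 1
    funext n
    have h1 : x - ((n : ℝ) + 1) ≠ 0 := sub_natCast_add_one_ne_zero hx n
    have h2 : -x + ((n : ℝ) + 1) = -(x - ((n : ℝ) + 1)) := by ring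
    have h3 : x ≠ 0 := h0.ne
    rw [h2, neg_sq]
    generalize x - ((n : ℝ) + 1) = w at h1
    field_simp
    ring
  rw [e]
  exact mul_nonpos_of_nonpos_of_nonneg (one_div_nonpos.2 h0.le) h

/-- For `x > 0` the left side decreases in `a`, so it is at most its limit at `0⁺`, which is bounded
by `∑ 1/(x - m)² + 1/x`. The term `1/x` is absorbed by the other half of the partial fractions of
`π² / sin²`. -/
lemma exp_mul_cSum_le (ha : 0 < a) (hx : ∀ n : ℤ, x ≠ n) (h0 : 0 < x) :
    Real.exp (a * x ^ 2) * cSum x a ≤ Real.pi ^ 2 / Real.sin (Real.pi * x) ^ 2 := by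
  have hanti : AntitoneOn (fun b => Real.exp (b * x ^ 2) * cSum x b) (Set.Ioi 0) := by
    refine antitoneOn_of_deriv_nonpos (convex_Ioi 0)
      (fun b hb => (hasDerivAt_exp_mul_cSum hb hx).continuousAt.continuousWithinAt)
      (fun b hb => (hasDerivAt_exp_mul_cSum (interior_subset hb)
        hx).differentiableAt.differentiableWithinAt) fun b hb => ?_
    have hb' := interior_subset hb
    rw [(hasDerivAt_exp_mul_cSum hb' hx).deriv]
    have h1 := pSum_nonneg hb'
    have h2 := rSum_nonneg hb'
    rw [neg_nonpos]
    positivity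
  -- The exact behaviour of `b * gmoment 1 b` is not needed: its upper bound `(exp b + 1) / 4` from
  -- `mul_gmoment_one_le` has limit `1/2`.
  have hlim : Tendsto (fun b => Real.exp (b * x ^ 2) *
      (gsum (fun n => 1 / (x - ((n : ℝ) + 1)) ^ 2) b + 2 * (b * gmoment 0 b) +
      2 / x * ((Real.exp (b * 1 ^ 2) + 1) / 4) -
      2 * x * (b * gsum (fun n => 1 / (x - ((n : ℝ) + 1))) b))) (𝓝[>] 0)
      (𝓝 (1 * (∑' n : ℕ, 1 / (x - ((n : ℝ) + 1)) ^ 2 + 2 * 0 + 2 / x * ((1 + 1) / 4) -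
        2 * x * 0))) :=
    (tendsto_exp_mul_sq x).mul ((((tendsto_gsum_inv_sub_sq hx).add
      (tendsto_mul_gmoment_zero.const_mul 2)).add
      ((((tendsto_exp_mul_sq 1).add_const 1).div_const 4).const_mul (2 / x))).sub
      ((tendsto_mul_gsum_inv_sub hx).const_mul (2 * x)))
  have hle := ge_of_tendsto hlim (b := Real.exp (a * x ^ 2) * cSum x a) ?_
  · refine hle.trans ?_
    rw [pi_sq_div_sin_sq hx]
    have h1 := one_div_le_inv_sq_add_tsum hx h0
    have h2 : 2 / x * ((1 + 1) / 4) = 1 / x := by ring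
    rw [h2]
    linarith
  · filter_upwards [Ioo_mem_nhdsGT ha] with b hb
    have hb0 : 0 < b := hb.1
    refine (hanti hb0 ha hb.2.le).trans ?_
    simp only
    rw [cSum_eq hb0 hx]
    have h1 := mul_gmoment_one_le hb0
    gcongr
    rw [one_pow, mul_one]
    linarith

/-- In the symmetric combination the `r` terms cancel and the `1/x²` term contributes `exp (a x²)`.
The derivative is `exp (a x²) (1 - 2 p(a)) ≥ 0`, and the limit at `0⁺` is the full partial fraction
series. -/
lemma pi_sq_div_sin_sq_le (ha : 0 < a) (hx : ∀ n : ℤ, x ≠ n) :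
    Real.pi ^ 2 / Real.sin (Real.pi * x) ^ 2 ≤
      Real.exp (a * x ^ 2) * (1 / x ^ 2 + cSum x a + cSum (-x) a) := by
  have h0 : x ≠ 0 := by simpa using hx 0
  have hx' := ne_intCast_neg hx
  set f : ℝ → ℝ := fun b => Real.exp (b * x ^ 2) * (1 / x ^ 2) +
    Real.exp (b * x ^ 2) * cSum x b + Real.exp (b * (-x) ^ 2) * cSum (-x) b with hf
  have hd : ∀ b, 0 < b → HasDerivAt f (Real.exp (b * x ^ 2) * (1 - 2 * pSum b)) b := by
    intro b hb
    have h1 : HasDerivAt (fun b => Real.exp (b * x ^ 2)) (Real.exp (b * x ^ 2) * (1 * x ^ 2)) b :=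
      ((hasDerivAt_id b).mul_const (x ^ 2)).exp
    refine (((h1.mul_const (1 / x ^ 2)).add (hasDerivAt_exp_mul_cSum hb hx)).add
      (hasDerivAt_exp_mul_cSum hb hx')).congr_deriv ?_
    rw [neg_sq]
    field_simp
    ring
  have hmono : MonotoneOn f (Set.Ioi 0) := by
    refine monotoneOn_of_deriv_nonneg (convex_Ioi 0)
      (fun b hb => (hd b hb).continuousAt.continuousWithinAt)
      (fun b hb => (hd b (interior_subset hb)).differentiableAt.differentiableWithinAt)
      fun b hb => ?_
    have hb' : 0 < b := interior_subset hb
    rw [(hd b hb').deriv]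
    have h1 := pSum_le_half hb'
    exact mul_nonneg (Real.exp_pos _).le (by linarith)
  have hlim : Tendsto (fun b => Real.exp (b * x ^ 2) * (1 / x ^ 2 +
      (gsum (fun n => 1 / (x - ((n : ℝ) + 1)) ^ 2) b + 2 * (b * gmoment 0 b) -
        2 * x * (b * gsum (fun n => 1 / (x - ((n : ℝ) + 1))) b)) +
      (gsum (fun n => 1 / (-x - ((n : ℝ) + 1)) ^ 2) b + 2 * (b * gmoment 0 b) -
        2 * (-x) * (b * gsum (fun n => 1 / (-x - ((n : ℝ) + 1))) b)))) (𝓝[>] 0)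
      (𝓝 (1 * (1 / x ^ 2 + (∑' n : ℕ, 1 / (x - ((n : ℝ) + 1)) ^ 2 + 2 * 0 - 2 * x * 0) +
        (∑' n : ℕ, 1 / (-x - ((n : ℝ) + 1)) ^ 2 + 2 * 0 - 2 * (-x) * 0)))) :=
    (tendsto_exp_mul_sq x).mul (((((tendsto_gsum_inv_sub_sq hx).add
      (tendsto_mul_gmoment_zero.const_mul 2)).sub
      ((tendsto_mul_gsum_inv_sub hx).const_mul (2 * x))).const_add _).add
      (((tendsto_gsum_inv_sub_sq hx').add
      (tendsto_mul_gmoment_zero.const_mul 2)).sub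
      ((tendsto_mul_gsum_inv_sub hx').const_mul (2 * (-x)))))
  have hle := le_of_tendsto hlim (b := f a) ?_
  · have e : f a = Real.exp (a * x ^ 2) * (1 / x ^ 2 + cSum x a + cSum (-x) a) := by
      rw [hf]
      simp only [neg_sq]
      ring
    rw [← e, pi_sq_div_sin_sq hx]
    linarith
  · filter_upwards [Ioo_mem_nhdsGT ha] with b hb
    have hb0 : 0 < b := hb.1
    refine le_trans (le_of_eq ?_) (hmono hb0 ha hb.2.le)
    rw [hf]
    simp only [neg_sq]
    rw [cSum_eq hb0 hx, cSum_eq hb0 hx']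
    ring

end Inequalities

end TruncatedGaussian


/-! ### Extremality, and evaluation of the integrals -/

namespace TruncatedGaussian

section Extremality

lemma IsEntireOfExpType.neg {σ : ℝ} {F : ℂ → ℂ} (hF : IsEntireOfExpType σ F) :
    IsEntireOfExpType σ (fun z => -F z) :=
  ⟨hF.1.neg, fun ε hε => by simpa using hF.2 ε hε⟩

lemma IsEntireOfExpType.add {σ : ℝ} {F H : ℂ → ℂ} (hF : IsEntireOfExpType σ F)
    (hH : IsEntireOfExpType σ H) : IsEntireOfExpType σ (fun z => F z + H z) := by
  simpa using hF.sub hH.neg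

lemma IsEntireOfExpType.summable_re {F : ℂ → ℂ} (hF : IsEntireOfExpType (2 * Real.pi) F)
    (hint : Integrable fun x : ℝ => F x) : Summable fun n : ℤ => (F ((n : ℝ) : ℂ)).re := by
  have h := hF.summable_add_int hint 0
  simp only [zero_add] at h
  exact (Complex.hasSum_re h.hasSum).summable

lemma IsEntireOfExpType.integral_re_eq_tsum {F : ℂ → ℂ} (hF : IsEntireOfExpType (2 * Real.pi) F)
    (hint : Integrable fun x : ℝ => F x) :
    ∫ x : ℝ, (F x).re = ∑' n : ℤ, (F ((n : ℝ) : ℂ)).re := by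
  have h := hF.summable_add_int hint 0
  have h1 := hF.tsum_add_int hint 0
  simp only [zero_add] at h h1
  have h2 : ∫ x : ℝ, (F x).re = (∫ x : ℝ, F x).re := integral_re hint
  rw [h2, ← h1, Complex.re_tsum h]

/-- The difference `g - Re F` has a minimum at the contact point. -/
lemma deriv_re_eq_of_touching {F : ℂ → ℂ} (hF : Differentiable ℂ F) {g : ℝ → ℝ} {x : ℝ}
    (hle : ∀ y : ℝ, (F y).re ≤ g y) (hg : DifferentiableAt ℝ g x) (h : (F x).re = g x) :
    (deriv F x).re = deriv g x := by
  have h1 : HasDerivAt (fun y : ℝ => (F y).re) (deriv F x).re x :=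
    (hF x).hasDerivAt.real_of_complex
  have h2 := hg.hasDerivAt.sub h1
  have hmin : IsLocalMin (g - fun y : ℝ => (F y).re) x :=
    Eventually.of_forall fun y => by
      simp only [Pi.sub_apply, h, sub_self, sub_nonneg]
      exact hle y
  have := hmin.hasDerivAt_eq_zero h2
  linarith

lemma deriv_im_eq_zero {F : ℂ → ℂ} (hF : Differentiable ℂ F) (hr : ∀ y : ℝ, (F y).im = 0)
    (x : ℝ) : (deriv F x).im = 0 := by
  have h1 : HasDerivAt (fun y : ℝ => (-Complex.I * F y).re) (-Complex.I * deriv F x).re x :=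
    ((hF x).hasDerivAt.const_mul (-Complex.I)).real_of_complex
  simp only [neg_mul, Complex.neg_re, Complex.mul_re, Complex.I_re, Complex.I_im, zero_mul,
    one_mul, zero_sub, neg_neg, hr] at h1
  exact h1.unique (hasDerivAt_const x 0)

/-- One-sided approximation: a minorant `F₀` interpolating `g` at the integers to second order is
the unique extremal minorant. -/
theorem extremal_minorant {g : ℝ → ℝ} {F₀ : ℂ → ℂ} (hg : Integrable g)
    (hF₀ : IsEntireOfExpType (2 * Real.pi) F₀) (hr₀ : ∀ x : ℝ, (F₀ x).im = 0)
    (hle₀ : ∀ x : ℝ, (F₀ x).re ≤ g x) (hint₀ : Integrable fun x : ℝ => F₀ x)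
    (hdiff : ∀ n : ℤ, n ≠ 0 → DifferentiableAt ℝ g n)
    (hval : ∀ n : ℤ, n ≠ 0 → (F₀ ((n : ℝ) : ℂ)).re = g n)
    {F : ℂ → ℂ} (hF : IsEntireOfExpType (2 * Real.pi) F) (hr : ∀ x : ℝ, (F x).im = 0)
    (hle : ∀ x : ℝ, (F x).re ≤ g x) (hzero : (F 0).re ≤ (F₀ 0).re) :
    (((∫ x, g x) - ∫ x : ℝ, (F₀ x).re : ℝ) : EReal) ≤
        ((∫⁻ x : ℝ, ENNReal.ofReal (g x - (F x).re) : ℝ≥0∞) : EReal) ∧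
      (((∫⁻ x : ℝ, ENNReal.ofReal (g x - (F x).re) : ℝ≥0∞) : EReal) =
        (((∫ x, g x) - ∫ x : ℝ, (F₀ x).re : ℝ) : EReal) ↔ F = F₀) := by
  have hcoe : ∀ H : ℂ → ℂ, (∀ x : ℝ, (H x).re ≤ g x) → Integrable (fun x : ℝ => H x) →
      ((∫⁻ x : ℝ, ENNReal.ofReal (g x - (H x).re) : ℝ≥0∞) : EReal) =
        (((∫ x, g x) - ∫ x : ℝ, (H x).re : ℝ) : EReal) := by
    intro H hH hi
    have hre : Integrable fun x : ℝ => (H x).re := hi.re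
    have hnn : 0 ≤ᵐ[volume] fun x => g x - (H x).re :=
      Eventually.of_forall fun x => sub_nonneg.2 (hH x)
    have hi' : Integrable fun x => g x - (H x).re := hg.sub hre
    rw [← ofReal_integral_eq_lintegral_ofReal hi' hnn, ← integral_sub hg hre,
      EReal.coe_ennreal_ofReal, max_eq_left (integral_nonneg_of_ae hnn)]
  by_cases htop : ∫⁻ x : ℝ, ENNReal.ofReal (g x - (F x).re) = ⊤
  -- An infinite defect satisfies the inequality trivially and excludes `F = F₀`, whose defect is
  -- finite.
  · refine ⟨by rw [htop]; exact le_top, fun h => ?_, fun h => ?_⟩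
    · rw [htop] at h
      exact absurd h.symm (EReal.coe_ne_top _)
    · rw [h]
      exact hcoe F₀ hle₀ hint₀
  have hcont : Continuous fun x : ℝ => F x := hF.1.continuous.comp Complex.continuous_ofReal
  have hsub : Integrable fun x : ℝ => g x - (F x).re := by
    refine ⟨hg.1.sub (Complex.continuous_re.comp hcont).aestronglyMeasurable, ?_⟩
    rw [hasFiniteIntegral_iff_ofReal (Eventually.of_forall fun x => sub_nonneg.2 (hle x))]
    exact lt_top_iff_ne_top.2 htop
  have hint : Integrable fun x : ℝ => F x := by
    have h1 : Integrable fun x : ℝ => (F x).re := by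
      refine (hg.sub hsub).congr (Eventually.of_forall fun x => ?_)
      simp
    refine h1.ofReal.congr (Eventually.of_forall fun x => ?_)
    exact Complex.ext (by simp) (by simp [hr x])
  have hs := hF.summable_re hint
  have hs₀ := hF₀.summable_re hint₀
  -- At the origin, where `g` may jump, domination comes from `hzero`; elsewhere `F₀` attains the
  -- upper bound `g n`.
  have hterm : ∀ n : ℤ, (F ((n : ℝ) : ℂ)).re ≤ (F₀ ((n : ℝ) : ℂ)).re := by
    intro n
    rcases eq_or_ne n 0 with rfl | hn
    · simpa using hzero
    · rw [hval n hn]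
      exact hle n
  have hI : ∫ x : ℝ, (F x).re ≤ ∫ x : ℝ, (F₀ x).re := by
    rw [hF.integral_re_eq_tsum hint, hF₀.integral_re_eq_tsum hint₀]
    exact hs.tsum_le_tsum hterm hs₀
  rw [hcoe F hle hint]
  refine ⟨by exact_mod_cast sub_le_sub_left hI _, fun h => ?_, fun h => by rw [h]⟩
  have h' : ∫ x : ℝ, (F₀ x).re = ∫ x : ℝ, (F x).re := by
    have := EReal.coe_eq_coe_iff.1 h
    linarith
  rw [hF.integral_re_eq_tsum hint, hF₀.integral_re_eq_tsum hint₀] at h'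
  have hz : HasSum (fun n : ℤ => (F₀ ((n : ℝ) : ℂ)).re - (F ((n : ℝ) : ℂ)).re) 0 := by
    have := hs₀.hasSum.sub hs.hasSum
    rwa [h', sub_self] at this
  -- Equal sums of termwise ordered series force equality term by term.
  have hvals : ∀ n : ℤ, (F ((n : ℝ) : ℂ)).re = (F₀ ((n : ℝ) : ℂ)).re := fun n => by
    have := congrFun ((hasSum_zero_iff_of_nonneg fun n => sub_nonneg.2 (hterm n)).1 hz) n
    simp only [Pi.zero_apply] at this
    linarith
  have hder : ∀ z, deriv (fun z => F z - F₀ z) z = deriv F z - deriv F₀ z := fun z =>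
    deriv_fun_sub (hF.1 z) (hF₀.1 z)
  -- `F` and `F₀` both touch `g` at each nonzero integer, so their difference has double zeros there
  -- and a zero at the origin.
  have h0 := (hF.sub hF₀).eq_zero_of_double_zeros (hint.sub hint₀) (fun n => ?_) fun n hn => ?_
  · funext z
    exact sub_eq_zero.1 (congrFun h0 z)
  · exact sub_eq_zero.2 (Complex.ext (hvals n) ((hr n).trans (hr₀ n).symm))
  · rw [hder, sub_eq_zero]
    refine Complex.ext ?_
      ((deriv_im_eq_zero hF.1 hr n).trans (deriv_im_eq_zero hF₀.1 hr₀ n).symm)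
    rw [deriv_re_eq_of_touching hF.1 hle (hdiff n hn) ((hvals n).trans (hval n hn)),
      deriv_re_eq_of_touching hF₀.1 hle₀ (hdiff n hn) (hval n hn)]

variable {lam : ℝ}

lemma gaussianPlus_of_pos {x : ℝ} (hx : 0 < x) :
    gaussianPlus lam x = Real.exp (-(Real.pi * lam) * x ^ 2) := by
  rw [gaussianPlus, if_pos hx, neg_mul]

lemma gaussianPlus_of_neg {x : ℝ} (hx : x < 0) : gaussianPlus lam x = 0 := by
  rw [gaussianPlus, if_neg hx.not_gt, if_neg hx.ne]

lemma gaussianPlus_zero : gaussianPlus lam 0 = 1 / 2 := by simp [gaussianPlus]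

lemma gaussianPlus_ae_eq : gaussianPlus lam =ᵐ[volume]
    (Set.Ioi (0 : ℝ)).indicator fun x => Real.exp (-(Real.pi * lam) * x ^ 2) := by
  filter_upwards [compl_mem_ae_iff.2 (measure_singleton (0 : ℝ))] with x hx
  have hx0 : x ≠ 0 := hx
  rcases lt_or_gt_of_ne hx0 with h | h
  · rw [gaussianPlus_of_neg h, Set.indicator_of_notMem]
    exact h.not_gt
  · rw [gaussianPlus_of_pos h, Set.indicator_of_mem]
    exact h

lemma integrable_gaussianPlus (hlam : 0 < lam) : Integrable (gaussianPlus lam) := by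
  have ha : 0 < Real.pi * lam := by have := Real.pi_pos; positivity
  exact ((integrable_exp_neg_mul_sq ha).indicator measurableSet_Ioi).congr gaussianPlus_ae_eq.symm

lemma integral_gaussianPlus (hlam : 0 < lam) :
    ∫ x, gaussianPlus lam x = 1 / (2 * √lam) := by
  rw [integral_congr_ae gaussianPlus_ae_eq, integral_indicator measurableSet_Ioi,
    integral_gaussian_Ioi]
  have hpi := Real.pi_pos
  rw [show Real.pi / (Real.pi * lam) = 1 / lam by field_simp, Real.sqrt_div zero_le_one,
    Real.sqrt_one]
  field_simp

lemma differentiableAt_gaussianPlus {x : ℝ} (hx : x ≠ 0) :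
    DifferentiableAt ℝ (gaussianPlus lam) x := by
  rcases lt_or_gt_of_ne hx with h | h
  · refine (differentiableAt_const (0 : ℝ)).congr_of_eventuallyEq ?_
    filter_upwards [eventually_lt_nhds h] with y hy using gaussianPlus_of_neg hy
  · have : DifferentiableAt ℝ (fun y : ℝ => Real.exp (-(Real.pi * lam) * y ^ 2)) x := by fun_prop
    refine this.congr_of_eventuallyEq ?_
    filter_upwards [eventually_gt_nhds h] with y hy using gaussianPlus_of_pos hy

lemma thetaValue_eq (hlam : 0 < lam) : thetaValue lam = 1 + 2 * gmoment 0 (Real.pi * lam) := by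
  have ha : 0 < Real.pi * lam := by have := Real.pi_pos; positivity
  have h : jacobiTheta₂ 0 (Complex.I * (lam : ℂ)) =
      ((∑' n : ℤ, Real.exp (-(Real.pi * lam) * (n : ℝ) ^ 2) : ℝ) : ℂ) := by
    rw [jacobiTheta₂, Complex.ofReal_tsum]
    refine tsum_congr fun n => ?_
    rw [jacobiTheta₂_term]
    push_cast
    congr 1
    linear_combination (Real.pi * n ^ 2 * lam : ℂ) * Complex.I_sq
  rw [thetaValue, h, Complex.ofReal_re, (hasSum_int_exp ha).tsum_eq]

lemma interp_intCast_of_pos (a : ℝ) {n : ℤ} (hn : 0 < n) :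
    interp a ((n : ℝ) : ℂ) = (Real.exp (-a * (n : ℝ) ^ 2) : ℝ) := by
  obtain ⟨k, rfl⟩ : ∃ k : ℕ, n = k + 1 := ⟨(n - 1).toNat, by omega⟩
  have := interp_natCast_add_one a k
  push_cast at this ⊢
  exact this

lemma interp_intCast_of_nonpos (a : ℝ) {n : ℤ} (hn : n ≤ 0) : interp a ((n : ℝ) : ℂ) = 0 := by
  simpa using interp_int_of_nonpos a hn

lemma interp_intCast_re (lam : ℝ) {n : ℤ} (hn : n ≠ 0) :
    (interp (Real.pi * lam) ((n : ℝ) : ℂ)).re = gaussianPlus lam n := by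
  rcases lt_or_gt_of_ne hn with h | h
  · rw [interp_intCast_of_nonpos _ h.le, gaussianPlus_of_neg (by exact_mod_cast h), Complex.zero_re]
  · rw [interp_intCast_of_pos _ h, gaussianPlus_of_pos (by exact_mod_cast h), Complex.ofReal_re]

lemma sin_sq_pos {x : ℝ} (hx : ∀ n : ℤ, x ≠ n) : 0 < Real.sin (Real.pi * x) ^ 2 := by
  exact (sq_nonneg _).lt_of_ne' (pow_ne_zero 2 (sin_pi_mul_ne_zero hx))

lemma interp_le_gaussianPlus (hlam : 0 < lam) (x : ℝ) :
    (interp (Real.pi * lam) x).re ≤ gaussianPlus lam x := by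
  have hpi := Real.pi_pos
  have ha : 0 < Real.pi * lam := by positivity
  by_cases hx : ∀ n : ℤ, x ≠ n
  · have hs := sin_sq_pos hx
    rw [interp_eq_cSum ha hx]
    rcases lt_or_gt_of_ne (by simpa using hx 0 : x ≠ 0) with h | h
    · rw [gaussianPlus_of_neg h]
      exact mul_nonpos_of_nonneg_of_nonpos (by positivity) (cSum_nonpos ha hx h)
    · rw [gaussianPlus_of_pos h]
      have h1 := exp_mul_cSum_le ha hx h
      rw [neg_mul, Real.exp_neg, ← one_div, le_div_iff₀ (Real.exp_pos _)]
      rw [le_div_iff₀ hs] at h1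
      rw [div_mul_eq_mul_div, div_mul_eq_mul_div, div_le_one (by positivity)]
      linarith
  · push Not at hx
    obtain ⟨n, rfl⟩ := hx
    rcases eq_or_ne n 0 with rfl | hn
    · rw [interp_intCast_of_nonpos _ le_rfl, Int.cast_zero, gaussianPlus_zero]
      norm_num
    · exact (interp_intCast_re lam hn).le

/-- Start from the two-sided bound `pi_sq_div_sin_sq_le`. For `x > 0`, drop `C(-x, a) ≤ 0`. For `x <
0`, subtract the upper bound `exp_mul_cSum_le` for `C(-x, a)`; what is left is the sign of `C(x, a)
+ 1/x²`. -/
lemma gaussianPlus_le_interp_add (hlam : 0 < lam) (x : ℝ) :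
    gaussianPlus lam x ≤ (interp (Real.pi * lam) x + csinc x ^ 2).re := by
  have hpi := Real.pi_pos
  have ha : 0 < Real.pi * lam := by positivity
  by_cases hx : ∀ n : ℤ, x ≠ n
  · have hs := sin_sq_pos hx
    have hx0 : x ≠ 0 := by simpa using hx 0
    have hx' := ne_intCast_neg hx
    have e : (csinc x ^ 2).re = Real.sin (Real.pi * x) ^ 2 / Real.pi ^ 2 * (1 / x ^ 2) := by
      rw [csinc_ofReal, ← Complex.ofReal_pow, Complex.ofReal_re,
        Real.sinc_of_ne_zero (mul_ne_zero hpi.ne' hx0), div_pow, mul_pow, div_mul_div_comm, mul_one]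
    have hD := pi_sq_div_sin_sq_le ha hx
    rw [Complex.add_re, interp_eq_cSum ha hx, e, ← mul_add]
    rcases lt_or_gt_of_ne hx0 with h | h
    · rw [gaussianPlus_of_neg h]
      have hE := exp_mul_cSum_le ha hx' (neg_pos.2 h)
      rw [mul_neg, Real.sin_neg, neg_sq, neg_sq] at hE
      have : 0 ≤ cSum x (Real.pi * lam) + 1 / x ^ 2 := by
        refine nonneg_of_mul_nonneg_right (a := Real.exp (Real.pi * lam * x ^ 2)) ?_
          (Real.exp_pos _)
        linarith
      positivity
    · rw [gaussianPlus_of_pos h]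
      have hB := cSum_nonpos ha hx' (neg_neg_of_pos h)
      rw [neg_mul, Real.exp_neg, ← one_div, div_le_iff₀ (Real.exp_pos _),
        div_mul_eq_mul_div, div_mul_eq_mul_div, le_div_iff₀ (by positivity), one_mul]
      have h1 : Real.exp (Real.pi * lam * x ^ 2) * (1 / x ^ 2 + cSum x (Real.pi * lam) +
          cSum (-x) (Real.pi * lam)) ≤ Real.exp (Real.pi * lam * x ^ 2) *
            (cSum x (Real.pi * lam) + 1 / x ^ 2) :=
        mul_le_mul_of_nonneg_left (by linarith) (Real.exp_pos _).le
      have h2 := hD.trans h1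
      rw [div_le_iff₀ hs] at h2
      linarith
  · push Not at hx
    obtain ⟨n, rfl⟩ := hx
    rcases eq_or_ne n 0 with rfl | hn
    · rw [interp_intCast_of_nonpos _ le_rfl, Int.cast_zero, gaussianPlus_zero]
      simp [csinc_zero]
      norm_num
    · have := csinc_int hn
      rw [← interp_intCast_re lam hn, Complex.ofReal_intCast, this]
      simp

lemma integral_interp_re {a : ℝ} (ha : 0 < a) : ∫ x : ℝ, (interp a x).re = gmoment 0 a := by
  rw [(isEntireOfExpType_interp ha).integral_re_eq_tsum (integrable_interp ha)]
  have hs := (polyGrowth_pow 0).summable ha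
  refine HasSum.tsum_eq ?_
  have h1 : HasSum (fun n : ℕ => (interp a (((n : ℤ) : ℝ) : ℂ)).re) (gmoment 0 a) := by
    rw [← hasSum_nat_add_iff' 1]
    have e : gmoment 0 a - ∑ i ∈ Finset.range 1, (interp a ((((i : ℕ) : ℤ) : ℝ) : ℂ)).re =
        gmoment 0 a := by
      simp only [Finset.range_one, Finset.sum_singleton]
      rw [interp_intCast_of_nonpos a (by simp)]
      simp
    rw [e]
    refine hs.hasSum.congr_fun fun n => ?_
    rw [interp_intCast_of_pos a (by positivity), Complex.ofReal_re]
    push_cast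
    rw [pow_zero, one_mul]
  have h2 : HasSum (fun n : ℕ => (interp a (((-((n : ℤ) + 1) : ℤ) : ℝ) : ℂ)).re) 0 := by
    refine hasSum_zero.congr_fun fun n => ?_
    rw [interp_intCast_of_nonpos a (by omega), Complex.zero_re]
  simpa using HasSum.of_nat_of_neg_add_one
    (f := fun n : ℤ => (interp a ((n : ℝ) : ℂ)).re) h1 h2

lemma integral_csinc_sq_re : ∫ x : ℝ, (csinc x ^ 2).re = 1 := by
  rw [isEntireOfExpType_csinc_sq.integral_re_eq_tsum integrable_csinc_sq, tsum_eq_single 0]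
  · simp [csinc_zero]
  · intro n hn
    rw [Complex.ofReal_intCast, csinc_int hn]
    simp

lemma interp_zero (a : ℝ) : interp a 0 = 0 := by
  simpa using interp_int_of_nonpos a le_rfl

end Extremality

end TruncatedGaussian

/-! ### The main theorem -/

open TruncatedGaussian

theorem theorem2 (lam : ℝ) (hlam : 0 < lam) :
    -- `L⁺_λ` and `M⁺_λ` are entire of exponential type at most `2π` and extend their series
    TruncatedGaussian.IsEntireOfExpType (2 * Real.pi) (TruncatedGaussian.Lplus lam) ∧
    TruncatedGaussian.IsEntireOfExpType (2 * Real.pi) (TruncatedGaussian.Mplus lam) ∧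
    (∀ z : ℂ, (∀ n : ℕ, z ≠ (n : ℂ)) →
      TruncatedGaussian.Lplus lam z = TruncatedGaussian.minorantSeries lam z ∧
      TruncatedGaussian.Mplus lam z = TruncatedGaussian.majorantSeries lam z) ∧
    -- they are real on the real line and satisfy `L⁺_λ ≤ G⁺_λ ≤ M⁺_λ` there
    (∀ x : ℝ, (TruncatedGaussian.Lplus lam (x : ℂ)).im = 0 ∧
      (TruncatedGaussian.Mplus lam (x : ℂ)).im = 0 ∧
      (TruncatedGaussian.Lplus lam (x : ℂ)).re ≤ TruncatedGaussian.gaussianPlus lam x ∧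
      TruncatedGaussian.gaussianPlus lam x ≤ (TruncatedGaussian.Mplus lam (x : ℂ)).re) ∧
    -- (i) minorants; the integral of a nonnegative function is taken in `[0, ∞]`
    (∀ L : ℂ → ℂ, TruncatedGaussian.IsEntireOfExpType (2 * Real.pi) L →
      (∀ x : ℝ, (L (x : ℂ)).im = 0 ∧
        (L (x : ℂ)).re ≤ TruncatedGaussian.gaussianPlus lam x) →
      ((-(TruncatedGaussian.thetaValue lam) / 2 + 1 / 2 + 1 / (2 * Real.sqrt lam) : ℝ) : EReal) ≤
        ((∫⁻ x : ℝ, ENNReal.ofReal (TruncatedGaussian.gaussianPlus lam x - (L (x : ℂ)).re) :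
          ℝ≥0∞) : EReal) ∧
      (((∫⁻ x : ℝ, ENNReal.ofReal (TruncatedGaussian.gaussianPlus lam x - (L (x : ℂ)).re) :
          ℝ≥0∞) : EReal) =
        ((-(TruncatedGaussian.thetaValue lam) / 2 + 1 / 2 + 1 / (2 * Real.sqrt lam) : ℝ) : EReal) ↔
        L = TruncatedGaussian.Lplus lam)) ∧
    -- (ii) majorants
    (∀ M : ℂ → ℂ, TruncatedGaussian.IsEntireOfExpType (2 * Real.pi) M →
      (∀ x : ℝ, (M (x : ℂ)).im = 0 ∧
        TruncatedGaussian.gaussianPlus lam x ≤ (M (x : ℂ)).re) →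
      ((TruncatedGaussian.thetaValue lam / 2 + 1 / 2 - 1 / (2 * Real.sqrt lam) : ℝ) : EReal) ≤
        ((∫⁻ x : ℝ, ENNReal.ofReal ((M (x : ℂ)).re - TruncatedGaussian.gaussianPlus lam x) :
          ℝ≥0∞) : EReal) ∧
      (((∫⁻ x : ℝ, ENNReal.ofReal ((M (x : ℂ)).re - TruncatedGaussian.gaussianPlus lam x) :
          ℝ≥0∞) : EReal) =
        ((TruncatedGaussian.thetaValue lam / 2 + 1 / 2 - 1 / (2 * Real.sqrt lam) : ℝ) : EReal) ↔
        M = TruncatedGaussian.Mplus lam)) := by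
  have hpi := Real.pi_pos
  have ha : 0 < Real.pi * lam := by positivity
  rw [Lplus_eq_interp hlam, Mplus_eq_interp hlam]
  have hL := isEntireOfExpType_interp ha
  have hM : IsEntireOfExpType (2 * Real.pi)
      (fun z => interp (Real.pi * lam) z + csinc z ^ 2) :=
    hL.add isEntireOfExpType_csinc_sq
  have hLim : ∀ x : ℝ, (interp (Real.pi * lam) x).im = 0 := fun x => by
    rw [interp_ofReal, Complex.ofReal_im]
  have hMim : ∀ x : ℝ, (interp (Real.pi * lam) x + csinc x ^ 2).im = 0 := fun x => by
    rw [Complex.add_im, hLim, csinc_ofReal, ← Complex.ofReal_pow, Complex.ofReal_im, add_zero]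
  refine ⟨hL, hM, fun z hz => ⟨(minorantSeries_eq_interp lam hz).symm,
    (majorantSeries_eq lam hz).symm⟩, fun x => ⟨hLim x, hMim x, interp_le_gaussianPlus hlam x,
    gaussianPlus_le_interp_add hlam x⟩, fun L hLt hLr => ?_, fun M hMt hMr => ?_⟩
  -- The value `1/2` of `G⁺` at `0` is not sharp: the limit from the left gives `L(0) ≤ 0`, the
  -- value of `L⁺`.
  · have hzero : (L 0).re ≤ (interp (Real.pi * lam) 0).re := by
      have hc : Tendsto (fun x : ℝ => (L x).re) (𝓝[<] 0) (𝓝 (L ((0 : ℝ) : ℂ)).re) :=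
        ((Complex.continuous_re.comp (hLt.1.continuous.comp
          Complex.continuous_ofReal)).tendsto 0).mono_left nhdsWithin_le_nhds
      rw [interp_zero, Complex.zero_re]
      rw [Complex.ofReal_zero] at hc
      refine le_of_tendsto hc ?_
      filter_upwards [self_mem_nhdsWithin] with x hx
      exact ((hLr x).2).trans_eq (gaussianPlus_of_neg hx)
    have h := extremal_minorant (integrable_gaussianPlus hlam) hL hLim
      (interp_le_gaussianPlus hlam) (integrable_interp ha)
      (fun n hn => differentiableAt_gaussianPlus (by exact_mod_cast hn))
      (fun n hn => interp_intCast_re lam hn) hLt (fun x => (hLr x).1) (fun x => (hLr x).2) hzero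
    have e : -(thetaValue lam) / 2 + 1 / 2 + 1 / (2 * √lam) =
        (∫ x, gaussianPlus lam x) - ∫ x : ℝ, (interp (Real.pi * lam) x).re := by
      rw [integral_gaussianPlus hlam, integral_interp_re ha, thetaValue_eq hlam]
      ring
    rw [e]
    exact h
  -- Likewise the limit from the right gives `M(0) ≥ 1`, the value of `M⁺`. The majorant problem is
  -- the minorant problem for `-G⁺`.
  · have hzero : (-M 0).re ≤ (-(interp (Real.pi * lam) 0 + csinc 0 ^ 2)).re := by
      have hc : Tendsto (fun x : ℝ => (M x).re) (𝓝[>] 0) (𝓝 (M ((0 : ℝ) : ℂ)).re) :=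
        ((Complex.continuous_re.comp (hMt.1.continuous.comp
          Complex.continuous_ofReal)).tendsto 0).mono_left nhdsWithin_le_nhds
      have hg : Tendsto (fun x : ℝ => Real.exp (-(Real.pi * lam) * x ^ 2)) (𝓝[>] 0) (𝓝 1) := by
        have : Tendsto (fun x : ℝ => Real.exp (-(Real.pi * lam) * x ^ 2)) (𝓝 0)
            (𝓝 (Real.exp (-(Real.pi * lam) * 0 ^ 2))) := Continuous.tendsto (by fun_prop) 0
        simpa using this.mono_left nhdsWithin_le_nhds
      rw [Complex.ofReal_zero] at hc
      have h1 : 1 ≤ (M 0).re := by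
        refine le_of_tendsto_of_tendsto hg hc ?_
        filter_upwards [self_mem_nhdsWithin] with x hx
        exact (gaussianPlus_of_pos hx).symm.trans_le (hMr x).2
      rw [interp_zero, csinc_zero]
      simpa using h1
    have hsI := integrable_csinc_sq
    have hLI := integrable_interp ha
    have h := extremal_minorant (g := fun x => -gaussianPlus lam x)
      (F₀ := fun z => -(interp (Real.pi * lam) z + csinc z ^ 2)) (F := fun z => -M z)
      (integrable_gaussianPlus hlam).neg hM.neg (fun x => by rw [Complex.neg_im, hMim, neg_zero])
      (fun x => by
        rw [Complex.neg_re]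
        exact neg_le_neg (gaussianPlus_le_interp_add hlam x)) (hLI.add hsI).neg
      (fun n hn => (differentiableAt_gaussianPlus (by exact_mod_cast hn)).neg)
      (fun n hn => by
        rw [Complex.neg_re, Complex.add_re, interp_intCast_re lam hn, Complex.ofReal_intCast,
          csinc_int hn]
        simp) hMt.neg (fun x => by rw [Complex.neg_im, (hMr x).1, neg_zero])
      (fun x => by
        rw [Complex.neg_re]
        exact neg_le_neg (hMr x).2) hzero
    have e : thetaValue lam / 2 + 1 / 2 - 1 / (2 * √lam) =
        (∫ x, -gaussianPlus lam x) -
          ∫ x : ℝ, (-(interp (Real.pi * lam) x + csinc x ^ 2)).re := by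
      have hsI' : Integrable fun x : ℝ => (csinc x ^ 2).re := hsI.re
      have hLI' : Integrable fun x : ℝ => (interp (Real.pi * lam) x).re := hLI.re
      simp only [Complex.neg_re, Complex.add_re]
      rw [integral_neg, integral_neg, integral_add hLI' hsI', integral_gaussianPlus hlam,
        integral_interp_re ha, integral_csinc_sq_re, thetaValue_eq hlam]
      ring
    rw [e]
    have hiff : (fun z => -M z) = (fun z => -(interp (Real.pi * lam) z + csinc z ^ 2)) ↔
        M = fun z => interp (Real.pi * lam) z + csinc z ^ 2 := by
      simp only [funext_iff, neg_inj]
    rw [← hiff]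
    simpa only [Complex.neg_re, neg_sub_neg] using h
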